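/- **Setting.** A marked line $p=(z,w,r)\in\mathbb R^3$ represents the space-time line $\ell(p)=\{(z+ws,s):s\in\mathbb R\}$ with mark (rod length) $r$. Its right half-plane is $\{(\tilde x,\tilde t):\tilde x\ge z+w\tilde t\}$ and its left half-plane is $\{(\tilde x,\tilde t):\tilde x<z+w\tilde t\}$. For space-time points $a,b\in\mathbb R^2$ let $ab$ be the set of marked lines meeting the closed segment $\overline{ab}$ (so $aa$ is the set of lines through $a$), let $ab_+$ be the set of lines in $ab$ with $a$ in the left and $b$ in the right half-plane, and $ab_-$ the set of those with $a$ in the right and $b$ in the left half-plane. For a measure $\nu$ on $\mathbb R^3$ put $d\nu_k=r^k\,d\nu$, and let $\mathcal M$ be the set of Borel measures $\mu$ on $\mathbb R^3$ with $\mu(ab)+\mu_2(ab)<\infty$ for all $a,b$. With $o=(0,0)$ define $$H_\nu(b)=\nu_1(ob_+)-\nu_1(ob_-),\qquad y_\nu(x,v;t)=x+vt+H_\nu(x+vt,t),$$ $$m_0^x(\nu)=\iiint r\,\bigl(\mathbf 1\{0\le z<x\}-\mathbf 1\{x\le z<0\}\bigr)\,d\nu(z,w,r),$$ and let $\nu_t$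 be the image of $\nu$ under $(z,w,r)\mapsto(z+wt,w,r)$. Here $y_\nu(x,v;\cdot)$ is the quasi-particle trajectory and $m_0^x(\nu_t)$ is the mass between $0$ and $x$ at time $t$. Let $\mu\in\mathcal M$. For $\varepsilon>0$ let $N[X^\varepsilon]$ be the empirical measure of a Poisson process $X^\varepsilon$ with intensity measure $\varepsilon^{-1}\mu$, and let $N^\varepsilon=\varepsilon N[X^\varepsilon]$. Let $W$ be a standard two-sided Brownian motion on $\mathbb R$ with $W(0)=0$. Define $$\widehat B^\varepsilon(x,v;t)=\varepsilon^{-1/2}\Bigl(\bigl[y_{N^\varepsilon}(x,v;t)-y_{N^\varepsilon}(x,v;0)\bigr]-\bigl[y_\mu(x,v;t)-y_\mu(x,v;0)\bigr]\Bigr),$$ $$\widehat B^\varepsilon(x;t)=\varepsilon^{-1/2}\bigl(\varepsilon\, m_0^x(N[X^\varepsilon]_t)-m_0^x(\mu_t)\bigr).$$ **Corollary (time changed Brownian motion).** 1. Let $x,v\in\mathbb R$ and $b_t=(x+vt,t)$, and suppose that $\mu_2(b_tb_t)=0$ for every $t\in\mathbb R$. Then, as $\varepsilon\downarrow0$, $$\bigl(\widehat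 B^\varepsilon(x,v;t)\bigr)_{t\in\mathbb R}\ \Longrightarrow\ \bigl(W(\operatorname{sgn}(t)\,\mu_2(b_0b_t))\bigr)_{t\in\mathbb R}.$$ 2. Let $t\in\mathbb R$ and $a_x=(x,t)$, and suppose that $\mu_2(a_xa_x)=0$ for every $x\in\mathbb R$. Then, as $\varepsilon\downarrow0$, $$\bigl(\widehat B^\varepsilon(x;t)\bigr)_{x\in\mathbb R}\ \Longrightarrow\ \bigl(W(\operatorname{sgn}(x)\,\mu_2(a_0a_x))\bigr)_{x\in\mathbb R}.$$ (Here $\mu_2(a_0a_x)$ is the $(\mu_t)_2$-measure of the lines meeting the segment from $(0,0)$ to $(x,0)$.) Here $\Rightarrow$ is functional convergence in law for the topology of uniform convergence on compact subsets of $\mathbb R$, in the sense of Hoffmann-Jørgensen: $Z^\varepsilon\Rightarrow Y$ means that $Y$ is a Borel random element with separable range, and $E^*F(Z^\varepsilon)\to E\,F(Y)$ for every bounded continuous functional $F$ of the path, where $E^*$ is the outer expectation. -/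

import Mathlib

open MeasureTheory ProbabilityTheory Filter Topology
open scoped ENNReal NNReal UniformConvergence BoundedContinuousFunction

noncomputable section

namespace HardRods

/-! ### Marked lines in the space-time plane -/

/-- A marked line `(x, v, r)`: position `x` at time zero, velocity `v`, mark (rod length) `r`. -/
abbrev MarkedLine : Type := ℝ × ℝ × ℝ

/-- The space-time line `{(x + v t, t) : t ∈ ℝ}`; points of the plane are pairs `(space, time)`. -/
def line (p : MarkedLine) : Set (ℝ × ℝ) := Set.range fun t : ℝ => (p.1 + p.2.1 * t, t)

/-- The right half-plane of a line; it contains the line. -/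
def rightHalf (p : MarkedLine) : Set (ℝ × ℝ) := {q | p.1 + q.2 * p.2.1 ≤ q.1}

/-- The (open) left half-plane of a line. -/
def leftHalf (p : MarkedLine) : Set (ℝ × ℝ) := {q | q.1 < p.1 + q.2 * p.2.1}

/-- The set `ab` of lines that intersect the closed segment with extremes `a` and `b`.
In particular `aa` is the set of lines through `a`. -/
def linesMeeting (a b : ℝ × ℝ) : Set MarkedLine := {p | (line p ∩ segment ℝ a b).Nonempty}

/-- The set `ab₊` of lines in `ab` with `a` on the left and `b` on the right. -/
def linesPos (a b : ℝ × ℝ) : Set MarkedLine :=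
  {p | p ∈ linesMeeting a b ∧ a ∈ leftHalf p ∧ b ∈ rightHalf p}

/-- The set `ab₋` of lines in `ab` with `a` on the right and `b` on the left. -/
def linesNeg (a b : ℝ × ℝ) : Set MarkedLine :=
  {p | p ∈ linesMeeting a b ∧ a ∈ rightHalf p ∧ b ∈ leftHalf p}

/-- The measure `μ₂`, with `dμ₂(x, v, r) = r² dμ(x, v, r)`. -/
def markSq (μ : Measure MarkedLine) : Measure MarkedLine :=
  μ.withDensity fun p => ENNReal.ofReal (p.2.2 ^ 2)

/-- The class `𝓜` of measures with `μ(ab) + μ₂(ab) < ∞` for all `a`, `b`. -/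
def IsAdmissible (μ : Measure MarkedLine) : Prop :=
  ∀ a b : ℝ × ℝ, μ (linesMeeting a b) + markSq μ (linesMeeting a b) < ∞

/-- The surface `H_ν(b) = ν₁(ob₊) - ν₁(ob₋)`, where `dν₁ = r dν` and `o` is the origin. -/
def surface (ν : Measure MarkedLine) (b : ℝ × ℝ) : ℝ :=
  (∫ p in linesPos (0, 0) b, p.2.2 ∂ν) - ∫ p in linesNeg (0, 0) b, p.2.2 ∂ν

/-! ### Hard rod observables -/

/-- The position `y_ν(x, v; t) = x + v t + H_ν(x + v t, t)` at time `t` of the quasi-particle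
with velocity `v` that starts at the dilated position of `x`. -/
def quasiParticle (ν : Measure MarkedLine) (x v t : ℝ) : ℝ :=
  x + v * t + surface ν (x + v * t, t)

/-- The measure `ν_t`: the image of `ν` under the ideal gas evolution `(x, v, r) ↦ (x + v t, v, r)`. -/
def evolve (t : ℝ) (ν : Measure MarkedLine) : Measure MarkedLine :=
  ν.map fun p => (p.1 + p.2.1 * t, p.2.1, p.2.2)

/-- The signed mass `m_0^x(ν) = ∫ r (1{0 ≤ z < x} - 1{x ≤ z < 0}) dν(z, w, r)`. -/
def mass (x : ℝ) (ν : Measure MarkedLine) : ℝ :=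
  ∫ p, p.2.2 * ((Set.Ico 0 x).indicator 1 p.1 - (Set.Ico x 0).indicator 1 p.1) ∂ν

/-! ### Random objects -/

/-- `N` is (the empirical measure of) a Poisson process with intensity measure `μ`: a random
measure whose value on a measurable set of finite `μ`-measure `m` is a Poisson variable with
mean `m`, and whose values on pairwise disjoint measurable sets are independent. -/
structure IsPoissonProcess {Ω : Type*} [MeasurableSpace Ω] (P : Measure Ω)
    (N : Ω → Measure MarkedLine) (μ : Measure MarkedLine) : Prop where
  measurable : Measurable N
  hasLaw : ∀ A : Set MarkedLine, MeasurableSet A → μ A ≠ ∞ →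
    HasLaw (fun ω => N ω A) ((poissonMeasure (μ A).toNNReal).map (Nat.cast : ℕ → ℝ≥0∞)) P
  indep : ∀ (n : ℕ) (A : Fin n → Set MarkedLine), (∀ i, MeasurableSet (A i)) →
    Pairwise (fun i j => Disjoint (A i) (A j)) → iIndepFun (fun i ω => N ω (A i)) P

/-- `W` is a standard two-sided Brownian motion on `ℝ` with `W 0 = 0`. -/
structure IsTwoSidedBrownian {Ω : Type*} [MeasurableSpace Ω] (P : Measure Ω)
    (W : ℝ → Ω → ℝ) : Prop where
  zero : ∀ᵐ ω ∂P, W 0 ω = 0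
  hasLaw_increment : ∀ s t : ℝ, s ≤ t →
    HasLaw (fun ω => W t ω - W s ω) (gaussianReal 0 (t - s).toNNReal) P
  indep_increments : HasIndepIncrements W P
  continuous_paths : ∀ᵐ ω ∂P, Continuous fun t => W t ω

/-- The outer expectation of a bounded, not necessarily measurable, function. -/
def outerExpectation {Ω : Type*} [MeasurableSpace Ω] (P : Measure Ω) (f : Ω → ℝ) : ℝ :=
  sInf {c | ∃ g : Ω → ℝ, Integrable g P ∧ (∀ ω, f ω ≤ g ω) ∧ c = ∫ ω, g ω ∂P}

/-- All functions `ℝ → ℝ`, with the topology of uniform convergence on compact sets. -/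
abbrev PathSpace : Type := ℝ →ᵤ[{K : Set ℝ | IsCompact K}] ℝ

/-- A function `ℝ → ℝ` as a point of the path space. -/
def toPath (f : ℝ → ℝ) : PathSpace := UniformOnFun.ofFun {K : Set ℝ | IsCompact K} f

/-- Functional convergence in law, as `ε ↓ 0`, of the processes `X ε` (each on a probability space
of its own) to the process `Y`, in the sense of Hoffmann-Jørgensen for locally uniform
convergence: `Y` is a Borel random element with separable range, and `E* F(X ε) → E F(Y)` for
every bounded continuous functional `F` of the path. The outer expectation `E*` is used since the
paths of `X ε` have jumps, and need not be continuous from one and the same side. -/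
def TendstoInLaw {Ω : ℝ → Type*} [∀ ε, MeasurableSpace (Ω ε)] (P : ∀ ε, Measure (Ω ε))
    (X : ∀ ε, Ω ε → ℝ → ℝ) {Ω' : Type*} [MeasurableSpace Ω'] (P' : Measure Ω')
    (Y : Ω' → ℝ → ℝ) : Prop :=
  AEStronglyMeasurable (fun ω' => toPath (Y ω')) P' ∧
    ∀ F : PathSpace →ᵇ ℝ,
      Tendsto (fun ε => outerExpectation (P ε) fun ω => F (toPath (X ε ω))) (𝓝[>] 0)
        (𝓝 (∫ ω', F (toPath (Y ω')) ∂P'))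

/-! ### Fluctuation processes -/

/-- Fluctuations of the displacement of the quasi-particle during `[0, t]`,
`ε^{-1/2} ((y_{N^ε}(x,v;t) - y_{N^ε}(x,v;0)) - (y_μ(x,v;t) - y_μ(x,v;0)))`, where `N^ε = ε N` is
the rescaled empirical measure. -/
def quasiFluctuation (μ : Measure MarkedLine) (ε : ℝ) (N : Measure MarkedLine) (x v t : ℝ) : ℝ :=
  (√ε)⁻¹ *
    ((quasiParticle (ENNReal.ofReal ε • N) x v t - quasiParticle (ENNReal.ofReal ε • N) x v 0)
      - (quasiParticle μ x v t - quasiParticle μ x v 0))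

/-- Fluctuations of the mass at time `t` between `0` and `x`:
`ε^{-1/2} (ε m_0^x(N_t) - m_0^x(μ_t))`. -/
def massFluctuation (μ : Measure MarkedLine) (ε : ℝ) (N : Measure MarkedLine) (t x : ℝ) : ℝ :=
  (√ε)⁻¹ * (ε * mass x (evolve t N) - mass x (evolve t μ))

end HardRods

end

noncomputable section

namespace HardRods

/-! ### Integrals against a Poisson process -/

/-! Both fluctuation processes have the form `fluctuation μ ε (N ω) h`, where `h` sums the signed
marks of the lines crossed by a path `γ` (the quasi-particle's free path, or a horizontal segment at
time `t`) between its base point and its current point. Disjoint pieces of the path cross disjoint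
sets of lines, apart from lines through the endpoints, and the half-plane conventions assign each of
these to one side. A Poisson process is independent on disjoint sets, so the increments are
independent. Their limiting variance is the integral of the squared marks, which is the `μ₂` measure
of the lines crossed. This is the covariance structure of the time-changed Brownian motion.

Finite-dimensional limits come from the characteristic functional `IsPoissonProcess.integral_exp`.
The fluctuation of `h` has characteristic exponent `ε⁻¹ ∫ (e^{i√ε t h} - 1 - i√ε t h) dμ`, which
tends to `-t² ∫ h² dμ / 2`. Disjoint supports make the exponents add up, and Lévy's theorem gives
`tendsto_integral_fluctuation`.

For uniform control, Ottaviani's inequality on nested dyadic grids, together with one-sided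
continuity in the path parameter, bounds the supremum over a cell by the tail of a single
fluctuation (`IsSweep.measureReal_exists_gt_le`). The limiting tail is Gaussian, hence at most a
constant times the squared variance over `δ⁴`. Summed over the cells of a fine grid this is small,
because the variance function `G` is continuous. Outside an event of small outer probability the
process is therefore uniformly close to a step path determined by finitely many increments, as is
the limit (`tendstoInLaw_of_sweeps`).

Two sweeps are needed for the quasi-particle. Half-planes are closed on one side only, so slow lines
produce jumps continuous from the right and fast lines jumps continuous from the left
(`pairIncrement_crossing`). Each family is monotone and is treated separately in the maximal
inequality. The hypothesis that `μ₂` does not charge the lines through a point of the path makes `G`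
continuous and makes the boundary conventions irrelevant for the variance (`tendstoInLaw_of_path`).
-/

lemma lintegral_natCast_poissonMeasure (r : ℝ≥0) :
    ∫⁻ n : ℕ, (n : ℝ≥0∞) ∂(poissonMeasure r) = r := by
  -- The term at `0` vanishes, and shifting the index by one leaves `r` times the total mass of the
  -- Poisson law.
  have hs : HasSum (fun n : ℕ => Real.exp (-r) * (r : ℝ) ^ n / (n.factorial : ℝ) * n) r := by
    rw [← hasSum_nat_add_iff' 1]
    have := (hasSum_one_poissonMeasure r).mul_left (r : ℝ)
    simp only [Finset.range_one, Finset.sum_singleton, Nat.cast_zero, mul_zero, sub_zero]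
    convert! this using 1
    · ext n
      rw [Nat.factorial_succ]
      push_cast
      field_simp
      ring
    · simp
  rw [poissonMeasure, lintegral_sum_measure]
  simp only [lintegral_smul_measure, lintegral_dirac, smul_eq_mul]
  have : ∀ n : ℕ, ENNReal.ofReal (Real.exp (-r) * (r : ℝ) ^ n / (n.factorial : ℝ)) * n
      = ENNReal.ofReal (Real.exp (-r) * (r : ℝ) ^ n / (n.factorial : ℝ) * n) := by
    intro n
    rw [ENNReal.ofReal_mul (by positivity), ENNReal.ofReal_natCast]
  simp_rw [this]
  rw [← ENNReal.ofReal_tsum_of_nonneg (fun n => by positivity) hs.summable, hs.tsum_eq,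
    ENNReal.ofReal_coe_nnreal]

variable {Ω : Type*} [MeasurableSpace Ω] {P : Measure Ω}
  {N : Ω → Measure MarkedLine} {ν : Measure MarkedLine}

lemma IsPoissonProcess.lintegral_apply (hN : IsPoissonProcess P N ν) {A : Set MarkedLine}
    (hA : MeasurableSet A) (hν : ν A ≠ ∞) : ∫⁻ ω, N ω A ∂P = ν A := by
  rw [(hN.hasLaw A hA hν).lintegral_comp (f := fun x => x) aemeasurable_id,
    lintegral_map (f := fun x => x) measurable_id .of_discrete, lintegral_natCast_poissonMeasure,
    ENNReal.coe_toNNReal hν]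

/-- Campbell's formula on a set of finite intensity. -/
lemma IsPoissonProcess.lintegral_setLIntegral (hN : IsPoissonProcess P N ν) {A : Set MarkedLine}
    (hA : MeasurableSet A) (hν : ν A ≠ ∞) {f : MarkedLine → ℝ≥0∞} (hf : Measurable f) :
    ∫⁻ ω, ∫⁻ p in A, f p ∂(N ω) ∂P = ∫⁻ p in A, f p ∂ν := by
  -- The law of `N ω B` is prescribed only when `ν B` is finite, so the mean measure and `ν` are
  -- compared inside `A`.
  have h1 : (P.bind N).restrict A = ν.restrict A := by
    ext B hB
    rw [Measure.restrict_apply hB, Measure.restrict_apply hB,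
      Measure.bind_apply (hB.inter hA) hN.measurable.aemeasurable,
      hN.lintegral_apply (hB.inter hA) (ne_top_of_le_ne_top hν (measure_mono Set.inter_subset_right))]
  rw [← h1, ← lintegral_indicator hA,
    Measure.lintegral_bind hN.measurable.aemeasurable (hf.indicator hA).aemeasurable]
  simp_rw [lintegral_indicator hA]

/-- By Campbell's formula on the support, the mean of `∫ |h| dN` is finite. -/
lemma IsPoissonProcess.ae_integrable (hN : IsPoissonProcess P N ν) {h : MarkedLine → ℝ}
    (hm : Measurable h) (hs : ν (Function.support h) ≠ ∞) (hi : Integrable h ν) :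
    ∀ᵐ ω ∂P, Integrable h (N ω) := by
  have hS : MeasurableSet (Function.support h) := measurableSet_support hm
  have h1 := hN.lintegral_setLIntegral hS hs hm.enorm
  have h2 : ∀ κ : Measure MarkedLine, ∫⁻ p in Function.support h, ‖h p‖ₑ ∂κ = ∫⁻ p, ‖h p‖ₑ ∂κ := by
    intro κ
    rw [← lintegral_indicator hS]
    congr 1
    ext p
    by_cases hp : h p = 0 <;> simp [hp]
  simp_rw [h2] at h1
  have h3 : Measurable fun ω => ∫⁻ p, ‖h p‖ₑ ∂(N ω) :=
    (Measure.measurable_lintegral hm.enorm).comp hN.measurable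
  filter_upwards [ae_lt_top h3 (by rw [h1]; exact hi.2.ne)] with ω hω
  exact ⟨hm.aestronglyMeasurable, hω⟩

/-- The Lebesgue integrals of the positive and negative parts depend measurably on the measure, and
their difference is the Bochner integral wherever `h` is integrable, that is, almost surely. -/
lemma IsPoissonProcess.aemeasurable_integral (hN : IsPoissonProcess P N ν) {h : MarkedLine → ℝ}
    (hm : Measurable h) (hs : ν (Function.support h) ≠ ∞) (hi : Integrable h ν) :
    AEMeasurable (fun ω => ∫ p, h p ∂(N ω)) P := by
  refine ⟨fun ω => (∫⁻ p, ENNReal.ofReal (h p) ∂(N ω)).toReal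
    - (∫⁻ p, ENNReal.ofReal (-h p) ∂(N ω)).toReal, ?_, ?_⟩
  · have h1 := (Measure.measurable_lintegral hm.ennreal_ofReal).comp hN.measurable
    have h2 := (Measure.measurable_lintegral hm.neg.ennreal_ofReal).comp hN.measurable
    exact h1.ennreal_toReal.sub h2.ennreal_toReal
  · filter_upwards [hN.ae_integrable hm hs hi] with ω hω
    exact integral_eq_lintegral_pos_part_sub_lintegral_neg_part hω

open Complex in
lemma IsPoissonProcess.integral_exp_count (hN : IsPoissonProcess P N ν) {A : Set MarkedLine}
    (hA : MeasurableSet A) (hν : ν A ≠ ∞) (a : ℝ) :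
    ∫ ω, exp (((N ω).real A * a : ℝ) * I) ∂P = exp (ν.real A * (exp (a * I) - 1)) := by
  have h1 := charFun_map_cast_poissonMeasure (ν A).toNNReal a
  have h2 := (hN.hasLaw A hA hν).integral_comp
    (f := fun x : ℝ≥0∞ => exp ((x.toReal * a : ℝ) * I)) (by
      apply Measurable.aestronglyMeasurable
      fun_prop)
  simp only [Function.comp_def] at h2
  rw [charFun_apply, integral_map .of_discrete (by fun_prop)] at h1
  simp only [measureReal_def]
  rw [h2, integral_map .of_discrete (by apply Measurable.aestronglyMeasurable; fun_prop)]
  simpa [mul_comm, ← ENNReal.coe_toNNReal_eq_toReal] using h1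

open Complex in
-- The counts on the level sets are independent Poisson variables, so the expectation factorises.
-- The zero level, possibly of infinite measure, is left out; it contributes to neither side.
lemma IsPoissonProcess.integral_exp_simpleFunc [IsProbabilityMeasure P]
    (hN : IsPoissonProcess P N ν)
    (f : SimpleFunc MarkedLine ℝ) (hf : Integrable f ν) :
    ∫ ω, exp ((∫ p, f p ∂(N ω) : ℝ) * I) ∂P = exp (∫ p, (exp (f p * I) - 1) ∂ν) := by
  classical
  set R := f.range.filter (· ≠ 0) with hR
  have hfin : ∀ y ∈ R, ν (f ⁻¹' {y}) ≠ ∞ := fun y hy =>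
    (SimpleFunc.integrable_iff.1 hf y (Finset.mem_filter.1 hy).2).ne
  have hfi : ∀ᵐ ω ∂P, Integrable f (N ω) := hN.ae_integrable f.measurable
    (SimpleFunc.measure_support_lt_top_of_integrable f hf).ne hf
  have hind : iIndepFun (fun (y : R) ω => N ω (f ⁻¹' {(y : ℝ)})) P := by
    have h := hN.indep R.card (fun i => f ⁻¹' {((R.equivFin.symm i : R) : ℝ)})
      (fun i => f.measurableSet_fiber _) (by
        intro i j hij
        refine Disjoint.preimage _ ?_
        simp only [Set.disjoint_singleton, ne_eq]
        exact fun h => hij (R.equivFin.symm.injective (Subtype.ext h)))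
    have := h.precomp R.equivFin.injective
    simpa using this
  have hsum : ∀ᵐ ω ∂P, exp ((∫ p, f p ∂(N ω) : ℝ) * I)
      = ∏ y : R, exp (((N ω).real (f ⁻¹' {(y : ℝ)}) * y : ℝ) * I) := by
    filter_upwards [hfi] with ω hω
    rw [SimpleFunc.integral_eq_integral f hω |>.symm, SimpleFunc.integral_eq, ← Complex.exp_sum,
      ← Finset.sum_mul]
    congr 2
    rw [← Finset.sum_filter_add_sum_filter_not f.range (· ≠ 0)]
    rw [Finset.sum_eq_zero (s := f.range.filter fun x => ¬ x ≠ 0) (by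
      intro x hx; simp at hx; simp [hx.2])]
    rw [add_zero, ← hR, ← Finset.sum_coe_sort, Complex.ofReal_sum]
    rfl
  have hint : ∫ p, (exp (f p * I) - 1) ∂ν
      = ∑ y : R, (ν.real (f ⁻¹' {(y : ℝ)}) : ℂ) * (exp ((y : ℝ) * I) - 1) := by
    have h1 : (fun p => exp (f p * I) - 1) = (f.map fun x : ℝ => exp (x * I) - 1) := by
      ext p; simp
    have h2 : Integrable (f.map fun x : ℝ => exp (x * I) - 1) ν := by
      rw [SimpleFunc.integrable_iff_finMeasSupp] at hf ⊢
      exact hf.map (by simp)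
    rw [h1, SimpleFunc.integral_eq_integral _ h2 |>.symm, SimpleFunc.map_integral f _ hf (by simp),
      ← Finset.sum_filter_add_sum_filter_not f.range (· ≠ 0)]
    rw [Finset.sum_eq_zero (s := f.range.filter fun x => ¬ x ≠ 0) (by
      intro x hx; simp at hx; simp [hx.2])]
    rw [add_zero, ← hR, ← Finset.sum_coe_sort]
    simp
  rw [integral_congr_ae hsum, hint, Complex.exp_sum]
  have hprod := (hind.comp (fun y x => exp ((x.toReal * (y : ℝ) : ℝ) * I)) (by
    intro y; fun_prop)).integral_fun_prod_eq_prod_integral (fun y => by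
      apply AEMeasurable.aestronglyMeasurable
      have : Measurable fun x : ℝ≥0∞ => exp ((x.toReal * (y : ℝ) : ℝ) * I) := by fun_prop
      exact this.comp_aemeasurable (hN.hasLaw _ (f.measurableSet_fiber _) (hfin y y.2)).aemeasurable)
  simp only [Function.comp_def] at hprod
  simp only [measureReal_def] at *
  rw [hprod]
  exact Finset.prod_congr rfl fun y _ => by
    simpa [measureReal_def] using! hN.integral_exp_count (f.measurableSet_fiber _) (hfin y y.2) y

open Complex in
/-- The characteristic functional of a Poisson process. -/
lemma IsPoissonProcess.integral_exp [IsProbabilityMeasure P]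
    (hN : IsPoissonProcess P N ν) {h : MarkedLine → ℝ} (hm : Measurable h)
    (hs : ν (Function.support h) ≠ ∞) (hi : Integrable h ν) :
    ∫ ω, exp ((∫ p, h p ∂(N ω) : ℝ) * I) ∂P = exp (∫ p, (exp (h p * I) - 1) ∂ν) := by
  set f : ℕ → SimpleFunc MarkedLine ℝ :=
    fun n => SimpleFunc.approxOn h hm Set.univ 0 (Set.mem_univ _) n with hf
  have hfi : ∀ n, Integrable (f n) ν := fun n =>
    SimpleFunc.integrable_approxOn hm hi _ (integrable_zero _ _ _) n
  have hle : ∀ n p, ‖f n p‖ ≤ ‖h p‖ + ‖h p‖ := fun n p =>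
    SimpleFunc.norm_approxOn_zero_le hm (Set.mem_univ _) p n
  have hlim : ∀ p, Tendsto (fun n => f n p) atTop (𝓝 (h p)) := fun p =>
    SimpleFunc.tendsto_approxOn hm (Set.mem_univ _) (by simp)
  have hconv : ∀ κ : Measure MarkedLine, Integrable h κ →
      Tendsto (fun n => ∫ p, f n p ∂κ) atTop (𝓝 (∫ p, h p ∂κ)) := fun κ hκ =>
    tendsto_integral_of_dominated_convergence (fun p => ‖h p‖ + ‖h p‖)
      (fun n => (f n).aestronglyMeasurable) (hκ.norm.add hκ.norm)
      (fun n => Eventually.of_forall (hle n)) (Eventually.of_forall hlim)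
  have hL : Tendsto (fun n => ∫ ω, exp ((∫ p, f n p ∂(N ω) : ℝ) * I) ∂P) atTop
      (𝓝 (∫ ω, exp ((∫ p, h p ∂(N ω) : ℝ) * I) ∂P)) := by
    refine tendsto_integral_of_dominated_convergence (fun _ => (1 : ℝ)) (fun n => ?_)
      (integrable_const _) (fun n => Eventually.of_forall fun ω => by
        rw [Complex.norm_exp_ofReal_mul_I]) ?_
    · have h1 := hN.aemeasurable_integral (f n).measurable
        (SimpleFunc.measure_support_lt_top_of_integrable _ (hfi n)).ne (hfi n)
      apply AEMeasurable.aestronglyMeasurable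
      fun_prop
    · filter_upwards [hN.ae_integrable hm hs hi] with ω hω
      have := hconv _ hω
      exact ((Complex.continuous_exp.comp (by fun_prop : Continuous fun x : ℝ => (x : ℂ) * I)).tendsto
        _).comp this
  have hR : Tendsto (fun n => exp (∫ p, (exp (f n p * I) - 1) ∂ν)) atTop
      (𝓝 (exp (∫ p, (exp (h p * I) - 1) ∂ν))) := by
    refine (Complex.continuous_exp.tendsto _).comp ?_
    refine tendsto_integral_of_dominated_convergence (fun p => ‖h p‖ + ‖h p‖) (fun n => ?_)
      (hi.norm.add hi.norm) (fun n => Eventually.of_forall fun p => ?_)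
      (Eventually.of_forall fun p => ?_)
    · apply Measurable.aestronglyMeasurable
      have := (f n).measurable
      fun_prop
    -- The bound `|e^{ix} - 1| ≤ |x|` turns the domination of the approximants into one of the
    -- integrands.
    · refine le_trans ?_ (hle n p)
      rw [mul_comm]
      exact Real.norm_exp_I_mul_ofReal_sub_one_le
    · exact ((by fun_prop : Continuous fun x : ℝ => exp ((x : ℂ) * I) - 1).tendsto _).comp (hlim p)
  have : (fun n => ∫ ω, exp ((∫ p, f n p ∂(N ω) : ℝ) * I) ∂P)
      = fun n => exp (∫ p, (exp (f n p * I) - 1) ∂ν) := by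
    ext n
    exact hN.integral_exp_simpleFunc (f n) (hfi n)
  rw [this] at hL
  exact tendsto_nhds_unique hL hR

end HardRods

namespace HardRods

/-! ### The fluctuation field -/

/-- The centred and rescaled integral `ε^{-1/2} (ε ∫ h dκ - ∫ h dμ)`. -/
def fluctuation (μ : Measure MarkedLine) (ε : ℝ) (κ : Measure MarkedLine)
    (h : MarkedLine → ℝ) : ℝ :=
  (√ε)⁻¹ * (ε * ∫ p, h p ∂κ - ∫ p, h p ∂μ)

/-- Square integrable functions with support of finite measure. -/
structure IsFinSq (μ : Measure MarkedLine) (h : MarkedLine → ℝ) : Prop where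
  measurable : Measurable h
  support : μ (Function.support h) ≠ ∞
  sq : Integrable (fun p => h p ^ 2) μ

variable {μ : Measure MarkedLine} {h g : MarkedLine → ℝ}

lemma IsFinSq.integrable (hh : IsFinSq μ h) : Integrable h μ := by
  have h1 : Integrable ((Function.support h).indicator fun _ => (1 : ℝ)) μ :=
    (integrable_indicator_iff (measurableSet_support hh.measurable)).2
      (integrableOn_const hh.support)
  -- On the support, `|h| ≤ 1 + h²`.
  refine (h1.add hh.sq).mono' hh.measurable.aestronglyMeasurable (Eventually.of_forall fun p => ?_)
  by_cases hp : h p = 0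
  · simp [hp]
  · simp only [Pi.add_apply, Real.norm_eq_abs]
    rw [Set.indicator_of_mem (by simpa using hp), ← sq_abs]
    nlinarith [sq_nonneg (|h p| - 1), abs_nonneg (h p)]

lemma IsFinSq.const_mul (hh : IsFinSq μ h) (a : ℝ) : IsFinSq μ fun p => a * h p where
  measurable := hh.measurable.const_mul a
  support := ne_top_of_le_ne_top hh.support (measure_mono fun p hp => by
    simp only [Function.mem_support] at hp ⊢
    exact right_ne_zero_of_mul hp)
  sq := by simpa only [mul_pow] using hh.sq.const_mul (a ^ 2)

lemma IsFinSq.zero : IsFinSq μ fun _ => 0 where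
  measurable := measurable_const
  support := by simp
  sq := by simp

lemma IsFinSq.add (hh : IsFinSq μ h) (hg : IsFinSq μ g) : IsFinSq μ fun p => h p + g p where
  measurable := hh.measurable.add hg.measurable
  support := by
    refine ne_top_of_le_ne_top (ENNReal.add_ne_top.2 ⟨hh.support, hg.support⟩)
      ((measure_mono fun p hp => ?_).trans (measure_union_le _ _))
    simp only [Function.mem_support, Set.mem_union] at hp ⊢
    by_contra! hc
    simp [hc.1, hc.2] at hp
  sq := by
    refine ((hh.sq.add hg.sq).const_mul 2).mono'
      ((hh.measurable.add hg.measurable).pow_const 2).aestronglyMeasurable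
      (Eventually.of_forall fun p => ?_)
    simp only [Pi.add_apply, Real.norm_eq_abs, abs_of_nonneg (sq_nonneg (h p + g p))]
    nlinarith [sq_nonneg (h p - g p)]

lemma IsFinSq.sum {ι : Type*} (s : Finset ι) {h : ι → MarkedLine → ℝ}
    (hh : ∀ i ∈ s, IsFinSq μ (h i)) : IsFinSq μ fun p => ∑ i ∈ s, h i p := by
  classical
  induction s using Finset.induction_on with
  | empty => simpa using IsFinSq.zero
  | insert i s his ih =>
    simp only [Finset.sum_insert his]
    exact (hh i (by simp)).add (ih fun j hj => hh j (by simp [hj]))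

lemma IsFinSq.indicator (hh : IsFinSq μ h) {A : Set MarkedLine} (hA : MeasurableSet A) :
    IsFinSq μ (A.indicator h) where
  measurable := hh.measurable.indicator hA
  support := ne_top_of_le_ne_top hh.support (measure_mono (by
    rw [Set.support_indicator]; exact Set.inter_subset_right))
  sq := by
    convert! hh.sq.indicator hA using 1
    ext p
    by_cases hp : p ∈ A <;> simp [hp]

section Field

variable {Ω : Type*} [MeasurableSpace Ω] {P : Measure Ω} [IsProbabilityMeasure P]
  {N : Ω → Measure MarkedLine} {ε : ℝ}

omit [IsProbabilityMeasure P] in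
lemma IsFinSq.ae_integrable (hh : IsFinSq μ h)
    (hN : IsPoissonProcess P N (ENNReal.ofReal ε⁻¹ • μ)) : ∀ᵐ ω ∂P, Integrable h (N ω) :=
  hN.ae_integrable hh.measurable
    (by simpa using ENNReal.mul_ne_top ENNReal.ofReal_ne_top hh.support)
    (hh.integrable.smul_measure ENNReal.ofReal_ne_top)

omit [IsProbabilityMeasure P] in
lemma IsFinSq.aemeasurable_fluctuation (hh : IsFinSq μ h)
    (hN : IsPoissonProcess P N (ENNReal.ofReal ε⁻¹ • μ)) :
    AEMeasurable (fun ω => fluctuation μ ε (N ω) h) P := by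
  have := hN.aemeasurable_integral hh.measurable
    (by simpa using ENNReal.mul_ne_top ENNReal.ofReal_ne_top hh.support)
    (hh.integrable.smul_measure ENNReal.ofReal_ne_top)
  unfold fluctuation
  fun_prop

lemma fluctuation_const_mul (κ : Measure MarkedLine) (a : ℝ) :
    fluctuation μ ε κ (fun p => a * h p) = a * fluctuation μ ε κ h := by
  simp only [fluctuation, integral_const_mul]
  ring

lemma fluctuation_sum {ι : Type*} (s : Finset ι) {h : ι → MarkedLine → ℝ} {κ : Measure MarkedLine}
    (hh : ∀ i ∈ s, Integrable (h i) μ) (hκ : ∀ i ∈ s, Integrable (h i) κ) :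
    fluctuation μ ε κ (fun p => ∑ i ∈ s, h i p) = ∑ i ∈ s, fluctuation μ ε κ (h i) := by
  simp only [fluctuation]
  rw [integral_finsetSum s hh, integral_finsetSum s hκ, Finset.mul_sum, ← Finset.sum_sub_distrib,
    Finset.mul_sum]

lemma fluctuation_add {κ : Measure MarkedLine}
    (hh : Integrable h μ) (hg : Integrable g μ) (hh' : Integrable h κ) (hg' : Integrable g κ) :
    fluctuation μ ε κ (fun p => h p + g p) = fluctuation μ ε κ h + fluctuation μ ε κ g := by
  simp only [fluctuation]
  rw [integral_add hh hg, integral_add hh' hg']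
  ring

open Complex in
/-- The compensated exponential `e^{i s x} - 1 - i s x`. -/
def compExp (s x : ℝ) : ℂ := exp ((s * x : ℝ) * I) - 1 - (s * x : ℝ) * I

lemma compExp_zero (s : ℝ) : compExp s 0 = 0 := by simp [compExp]

lemma continuous_compExp (s : ℝ) : Continuous (compExp s) := by
  unfold compExp; fun_prop

/-- Taylor's formula if `|s x| ≤ 1`, the triangle inequality otherwise. At `s = √ε` the factor `s²`
cancels the intensity factor `ε⁻¹`, which makes all later bounds uniform in `ε`. -/
lemma norm_compExp_le (s x : ℝ) : ‖compExp s x‖ ≤ 3 * s ^ 2 * x ^ 2 := by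
  have hn : ‖((s * x : ℝ) : ℂ) * Complex.I‖ = |s * x| := by
    rw [norm_mul, Complex.norm_real, Complex.norm_I, mul_one, Real.norm_eq_abs]
  have hsq : |s * x| ^ 2 = s ^ 2 * x ^ 2 := by rw [sq_abs, mul_pow]
  rcases le_total |s * x| 1 with h1 | h1
  · have := Complex.norm_exp_sub_one_sub_id_le (x := ((s * x : ℝ) : ℂ) * Complex.I) (by rwa [hn])
    rw [hn, hsq] at this
    unfold compExp
    nlinarith [sq_nonneg (s * x)]
  · unfold compExp
    refine (norm_sub_le _ _).trans ?_
    rw [hn]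
    have := norm_sub_le (Complex.exp (((s * x : ℝ) : ℂ) * Complex.I)) 1
    rw [Complex.norm_exp_ofReal_mul_I] at this
    simp only [norm_one] at this
    nlinarith

lemma IsFinSq.integrable_compExp (hh : IsFinSq μ h) (s : ℝ) :
    Integrable (fun p => compExp s (h p)) μ :=
  (hh.sq.const_mul (3 * s ^ 2)).mono'
    ((continuous_compExp s).measurable.comp hh.measurable).aestronglyMeasurable
    (Eventually.of_forall fun p => norm_compExp_le s (h p))

open Complex in
-- Since `ε / √ε = √ε`, this is the characteristic functional at `√ε h` for intensity `ε⁻¹ μ`. The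
-- deterministic centring equals `ε⁻¹ ∫ √ε h dμ` and supplies the linear compensator.
lemma IsFinSq.integral_exp_fluctuation (hh : IsFinSq μ h) (hε : 0 < ε)
    (hN : IsPoissonProcess P N (ENNReal.ofReal ε⁻¹ • μ)) :
    ∫ ω, exp ((fluctuation μ ε (N ω) h : ℝ) * I) ∂P
      = exp ((ε⁻¹ : ℝ) * ∫ p, compExp (√ε) (h p) ∂μ) := by
  have hs : (√ε)⁻¹ * ε = √ε := by
    rw [inv_mul_eq_div, Real.div_sqrt]
  have hs' : ε⁻¹ * √ε = (√ε)⁻¹ := by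
    rw [inv_mul_eq_div, Real.sqrt_div_self', one_div]
  have hc := hh.const_mul √ε
  have h1 := hN.integral_exp hc.measurable
    (by simpa using ENNReal.mul_ne_top ENNReal.ofReal_ne_top hc.support)
    (hc.integrable.smul_measure ENNReal.ofReal_ne_top)
  have h2 : ∀ ω, exp ((fluctuation μ ε (N ω) h : ℝ) * I)
      = exp ((∫ p, √ε * h p ∂(N ω) : ℝ) * I) * exp (-((√ε)⁻¹ * ∫ p, h p ∂μ : ℝ) * I) := by
    intro ω
    rw [← Complex.exp_add, ← add_mul, ← ofReal_neg, ← ofReal_add, fluctuation, mul_sub, ← mul_assoc,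
      hs, integral_const_mul]
    rfl
  simp_rw [h2]
  rw [integral_mul_const, h1, ← Complex.exp_add]
  congr 1
  have h3 : ∀ p, compExp (√ε) (h p)
      = (exp ((√ε * h p : ℝ) * I) - 1) - ((√ε * h p : ℝ) : ℂ) * I := fun p => rfl
  have hi1 : Integrable (fun p => ((√ε * h p : ℝ) : ℂ) * I) μ := hc.integrable.ofReal.mul_const I
  have hi2 : Integrable (fun p => exp ((√ε * h p : ℝ) * I) - 1) μ := by
    convert! (hh.integrable_compExp √ε).add hi1 using 1
    ext p
    simp [h3]
  simp_rw [h3]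
  have h4 : ∫ p, ((√ε * h p : ℝ) : ℂ) ∂μ = ((√ε * ∫ p, h p ∂μ : ℝ) : ℂ) := by
    rw [← integral_const_mul]
    exact integral_ofReal
  rw [integral_sub hi2 hi1, integral_smul_measure, integral_mul_const, h4,
    ENNReal.toReal_ofReal (by positivity), mul_sub, sub_eq_add_neg,
    ← hs']
  simp only [Complex.real_smul]
  push_cast
  ring

/-- The fluctuations of square integrable functions with disjoint supports are independent. -/
lemma iIndepFun_fluctuation {ι : Type*} {h : ι → MarkedLine → ℝ} (hε : 0 < ε)
    (hN : IsPoissonProcess P N (ENNReal.ofReal ε⁻¹ • μ)) (hh : ∀ i, IsFinSq μ (h i))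
    (hd : Pairwise fun i j => ∀ p, h i p = 0 ∨ h j p = 0) :
    iIndepFun (fun i ω => fluctuation μ ε (N ω) (h i)) P := by
  rw [iIndepFun_iff_finset]
  intro s
  change iIndepFun (fun (i : s) ω => fluctuation μ ε (N ω) (h i)) P
  rw [iIndepFun_iff_charFun_pi fun i : s => (hh i).aemeasurable_fluctuation hN]
  intro t
  have hm : AEMeasurable (fun ω => WithLp.toLp 2 fun i : s => fluctuation μ ε (N ω) (h i)) P :=
    (WithLp.measurable_toLp 2 _).comp_aemeasurable
      (aemeasurable_pi_lambda _ fun i => (hh i).aemeasurable_fluctuation hN)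
  have hht : ∀ i : s, IsFinSq μ fun p => t i * h i p := fun i => (hh i).const_mul (t i)
  rw [charFun_apply, integral_map hm (by fun_prop)]
  have h1 : ∀ᵐ ω ∂P, Complex.exp ((inner ℝ
        (WithLp.toLp 2 fun i : s => fluctuation μ ε (N ω) (h i)) t : ℝ) * Complex.I)
      = Complex.exp ((fluctuation μ ε (N ω) (fun p => ∑ i : s, t i * h i p) : ℝ) * Complex.I) := by
    have : ∀ᵐ ω ∂P, ∀ i : s, Integrable (fun p => t i * h i p) (N ω) := by
      rw [ae_all_iff]
      exact fun i => (hht i).ae_integrable hN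
    filter_upwards [this] with ω hω
    rw [fluctuation_sum _ (fun i _ => (hht i).integrable) (fun i _ => hω i)]
    simp_rw [fluctuation_const_mul]
    simp [PiLp.inner_apply]
  have h2 : ∀ i : s, charFun (P.map fun ω => fluctuation μ ε (N ω) (h i)) (t i)
      = Complex.exp ((ε⁻¹ : ℝ) * ∫ p, compExp (√ε) (t i * h i p) ∂μ) := by
    intro i
    rw [charFun_apply, integral_map ((hh i).aemeasurable_fluctuation hN) (by fun_prop),
      ← (hht i).integral_exp_fluctuation hε hN]
    simp_rw [fluctuation_const_mul]
    simp
  rw [integral_congr_ae h1,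
    (IsFinSq.sum Finset.univ fun i _ => hht i).integral_exp_fluctuation hε hN]
  simp_rw [h2]
  rw [← Complex.exp_sum, ← Finset.mul_sum,
    ← integral_finsetSum _ fun i _ => (hht i).integrable_compExp _]
  -- At each point at most one summand is nonzero and `compExp` vanishes at `0`, so `compExp` of the
  -- sum is the sum of the `compExp`s.
  congr 3
  ext p
  by_cases hp : ∃ i : s, h i p ≠ 0
  · obtain ⟨i, hi⟩ := hp
    have hz : ∀ j : s, j ≠ i → h j p = 0 := fun j hj =>
      (hd (fun e => hj (Subtype.ext e)) p).resolve_right hi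
    rw [Finset.sum_eq_single i (fun j _ hj => by rw [hz j hj, mul_zero]) (by simp),
      Finset.sum_eq_single i (fun j _ hj => by rw [hz j hj, mul_zero, compExp_zero]) (by simp)]
  · push Not at hp
    simp [hp, compExp_zero]

end Field

/-! ### The central limit theorem -/

/-- Linear in `a` without a smallness assumption: for `a ≥ 1` the trivial bound `2` suffices. -/
lemma norm_one_sub_exp_le {z : ℂ} {a : ℝ} (hz : ‖z‖ ≤ a) (h1 : ‖Complex.exp z‖ ≤ 1) :
    ‖1 - Complex.exp z‖ ≤ 2 * a := by
  rcases le_total a 1 with ha | ha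
  · have := Complex.norm_exp_sub_one_le (hz.trans ha)
    rw [norm_sub_rev]
    linarith
  · have := norm_sub_le 1 (Complex.exp z)
    simp only [norm_one] at this
    linarith

/-! ### Tail bounds uniform in `ε` -/

section Tail

variable {Ω : Type*} [MeasurableSpace Ω] {P : Measure Ω} [IsProbabilityMeasure P]
  {N : Ω → Measure MarkedLine} {ε : ℝ}

lemma IsFinSq.charFun_fluctuation (hh : IsFinSq μ h) (hε : 0 < ε)
    (hN : IsPoissonProcess P N (ENNReal.ofReal ε⁻¹ • μ)) (t : ℝ) :
    charFun (P.map fun ω => fluctuation μ ε (N ω) h) t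
      = Complex.exp ((ε⁻¹ : ℝ) * ∫ p, compExp (√ε) (t * h p) ∂μ) := by
  rw [charFun_apply, integral_map (hh.aemeasurable_fluctuation hN) (by fun_prop),
    ← (hh.const_mul t).integral_exp_fluctuation hε hN]
  simp_rw [fluctuation_const_mul]
  simp

/-- A Chebyshev-type bound from the characteristic function `φ` near zero: for `|t| ≤ 2/δ` one has
`|1 - φ(t)| ≤ 2 · 3t²σ ≤ 24σ/δ²`, and averaging over this interval, of length `4/δ`, with weight
`δ/2` gives `48`. Being uniform in `ε`, it verifies the hypothesis of Ottaviani's inequality. -/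
lemma IsFinSq.measureReal_fluctuation_gt_le (hh : IsFinSq μ h) (hε : 0 < ε)
    (hN : IsPoissonProcess P N (ENNReal.ofReal ε⁻¹ • μ)) {δ : ℝ} (hδ : 0 < δ) :
    P.real {ω | δ < |fluctuation μ ε (N ω) h|} ≤ 48 * (∫ p, h p ^ 2 ∂μ) / δ ^ 2 := by
  have hm := hh.aemeasurable_fluctuation hN
  have := Measure.isProbabilityMeasure_map hm
  set σ := ∫ p, h p ^ 2 ∂μ with hσ
  have hσ0 : 0 ≤ σ := integral_nonneg fun p => sq_nonneg _
  have h1 := measureReal_abs_gt_le_integral_charFun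
    (μ := P.map fun ω => fluctuation μ ε (N ω) h) hδ
  rw [map_measureReal_apply_of_aemeasurable hm
    (measurableSet_lt measurable_const (by fun_prop))] at h1
  have h2 : ∀ t ∈ Set.uIoc (-2 * δ⁻¹) (2 * δ⁻¹),
      ‖1 - charFun (P.map fun ω => fluctuation μ ε (N ω) h) t‖ ≤ 24 * σ / δ ^ 2 := by
    intro t ht
    have hδi : 0 < δ⁻¹ := by positivity
    rw [Set.uIoc_of_le (by linarith)] at ht
    have ht2 : t ^ 2 ≤ 4 / δ ^ 2 := by
      have : t ^ 2 ≤ (2 * δ⁻¹) ^ 2 := by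
        apply sq_le_sq'
        · linarith [ht.1]
        · exact ht.2
      calc t ^ 2 ≤ (2 * δ⁻¹) ^ 2 := this
        _ = 4 / δ ^ 2 := by field_simp; norm_num
    have hb := norm_charFun_le_one (μ := P.map fun ω => fluctuation μ ε (N ω) h) (t := t)
    rw [hh.charFun_fluctuation hε hN t] at hb ⊢
    refine (norm_one_sub_exp_le (a := 3 * t ^ 2 * σ) ?_ hb).trans ?_
    · have h3 : ‖∫ p, compExp (√ε) (t * h p) ∂μ‖ ≤ ε * (3 * t ^ 2 * σ) := by
        refine (norm_integral_le_of_norm_le (hh.sq.const_mul (ε * (3 * t ^ 2)))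
          (Eventually.of_forall fun p => (norm_compExp_le _ _).trans_eq ?_)).trans_eq ?_
        · rw [Real.sq_sqrt hε.le]; ring
        · rw [integral_const_mul]; ring
      rw [norm_mul, Complex.norm_real, Real.norm_of_nonneg (by positivity)]
      calc ε⁻¹ * _ ≤ ε⁻¹ * (ε * (3 * t ^ 2 * σ)) := by gcongr
        _ = _ := by field_simp
    · calc 2 * (3 * t ^ 2 * σ) ≤ 2 * (3 * (4 / δ ^ 2) * σ) := by gcongr
        _ = _ := by ring
  refine h1.trans ?_
  refine (mul_le_mul_of_nonneg_left (intervalIntegral.norm_integral_le_of_norm_le_const h2)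
    (by positivity)).trans_eq ?_
  rw [abs_of_nonneg (by have : 0 < δ⁻¹ := by positivity
                        linarith)]
  field_simp
  ring

end Tail

end HardRods

namespace HardRods

/-! ### Gaussian limit of the characteristic functions -/

lemma norm_compExp_add_le (s x : ℝ) :
    ‖compExp s x + ((s * x) ^ 2 / 2 : ℝ)‖ ≤ |s * x| ^ 3 * Real.exp |s * x| := by
  have hn : ‖((s * x : ℝ) : ℂ) * Complex.I‖ = |s * x| := by
    rw [norm_mul, Complex.norm_real, Complex.norm_I, mul_one, Real.norm_eq_abs]
  have := Complex.norm_exp_sub_sum_le_norm_mul_exp (((s * x : ℝ) : ℂ) * Complex.I) 3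
  rw [hn] at this
  refine le_of_eq_of_le ?_ this
  congr 1
  simp only [compExp, Finset.sum_range_succ, Finset.range_zero, Finset.sum_empty, mul_pow,
    Complex.I_sq]
  push_cast
  norm_num [Nat.factorial]
  ring

/-- The third-order Taylor remainder is of order `ε^{3/2}`, which beats the factor `ε⁻¹`. -/
lemma tendsto_inv_mul_compExp (x : ℝ) :
    Tendsto (fun ε : ℝ => (ε⁻¹ : ℝ) * compExp (√ε) x) (𝓝[>] 0) (𝓝 ((-(x ^ 2 / 2) : ℝ) : ℂ)) := by
  rw [tendsto_iff_norm_sub_tendsto_zero]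
  have hlim : Tendsto (fun ε : ℝ => √ε * |x| ^ 3 * Real.exp (√ε * |x|)) (𝓝[>] 0) (𝓝 0) := by
    have : Continuous fun ε : ℝ => √ε * |x| ^ 3 * Real.exp (√ε * |x|) := by fun_prop
    have h := this.tendsto 0
    simp only [Real.sqrt_zero, zero_mul] at h
    exact h.mono_left nhdsWithin_le_nhds
  refine squeeze_zero' (Eventually.of_forall fun _ => norm_nonneg _) ?_ hlim
  filter_upwards [self_mem_nhdsWithin] with ε hε
  have hε : 0 < ε := hε
  have hs : √ε ^ 2 = ε := Real.sq_sqrt hε.le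
  have h1 : (ε⁻¹ : ℝ) * compExp (√ε) x - ((-(x ^ 2 / 2) : ℝ) : ℂ)
      = (ε⁻¹ : ℝ) * (compExp (√ε) x + ((√ε * x) ^ 2 / 2 : ℝ)) := by
    rw [mul_pow, hs, mul_add, ← Complex.ofReal_mul, sub_eq_add_neg, ← Complex.ofReal_neg]
    congr 2
    field_simp
  rw [h1, norm_mul, Complex.norm_real, Real.norm_of_nonneg (by positivity)]
  have habs : |√ε * x| = √ε * |x| := by rw [abs_mul, abs_of_nonneg (Real.sqrt_nonneg _)]
  have h2 := norm_compExp_add_le (√ε) x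
  rw [habs] at h2
  calc ε⁻¹ * _ ≤ ε⁻¹ * ((√ε * |x|) ^ 3 * Real.exp (√ε * |x|)) := by gcongr
    _ = ε⁻¹ * √ε ^ 2 * (√ε * |x| ^ 3 * Real.exp (√ε * |x|)) := by ring
    _ = _ := by rw [hs, inv_mul_cancel₀ hε.ne', one_mul]

variable {μ : Measure MarkedLine} {h : MarkedLine → ℝ}

lemma IsFinSq.tendsto_exp_integral_compExp (hh : IsFinSq μ h) :
    Tendsto (fun ε : ℝ => Complex.exp ((ε⁻¹ : ℝ) * ∫ p, compExp (√ε) (h p) ∂μ)) (𝓝[>] 0)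
      (𝓝 (Complex.exp ((-((∫ p, h p ^ 2 ∂μ) / 2) : ℝ) : ℂ))) := by
  refine (Complex.continuous_exp.tendsto _).comp ?_
  simp_rw [← integral_const_mul]
  have h1 : (((-((∫ p, h p ^ 2 ∂μ) / 2) : ℝ) : ℂ)) = ∫ p, ((-(h p ^ 2 / 2) : ℝ) : ℂ) ∂μ := by
    rw [integral_complex_ofReal, integral_neg, integral_div]
  rw [h1]
  refine tendsto_integral_filter_of_dominated_convergence (fun p => 3 * h p ^ 2)
    (Eventually.of_forall fun ε => ?_) ?_ (hh.sq.const_mul 3)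
    (Eventually.of_forall fun p => tendsto_inv_mul_compExp (h p))
  · exact (((continuous_compExp _).measurable.comp hh.measurable).const_mul _).aestronglyMeasurable
  · filter_upwards [self_mem_nhdsWithin] with ε hε
    have hε : 0 < ε := hε
    refine Eventually.of_forall fun p => ?_
    have h2 := norm_compExp_le (√ε) (h p)
    rw [Real.sq_sqrt hε.le] at h2
    rw [norm_mul, Complex.norm_real, Real.norm_of_nonneg (by positivity)]
    calc ε⁻¹ * _ ≤ ε⁻¹ * (3 * ε * h p ^ 2) := by gcongr
      _ = _ := by field_simp

section Limit

variable {Ω : ℝ → Type*} [∀ ε, MeasurableSpace (Ω ε)] {P : ∀ ε, Measure (Ω ε)}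
  [∀ ε, IsProbabilityMeasure (P ε)] {N : ∀ ε, Ω ε → Measure MarkedLine}

/-- The central limit theorem for the fluctuations of a Poisson process along finitely many square
integrable functions with disjoint supports. -/
lemma tendsto_integral_fluctuation {ι : Type*} [Fintype ι] {h : ι → MarkedLine → ℝ}
    (hN : ∀ ε : ℝ, 0 < ε → IsPoissonProcess (P ε) (N ε) (ENNReal.ofReal ε⁻¹ • μ))
    (hh : ∀ i, IsFinSq μ (h i)) (hd : Pairwise fun i j => ∀ p, h i p = 0 ∨ h j p = 0)
    (Φ : (ι → ℝ) →ᵇ ℝ) :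
    Tendsto (fun ε => ∫ ω, Φ (fun i => fluctuation μ ε (N ε ω) (h i)) ∂(P ε)) (𝓝[>] 0)
      (𝓝 (∫ x, Φ x ∂(Measure.pi fun i =>
        gaussianReal 0 (∫ p, h i p ^ 2 ∂μ).toNNReal))) := by
  set V : ∀ ε, Ω ε → EuclideanSpace ℝ ι :=
    fun ε ω => WithLp.toLp 2 fun i => fluctuation μ ε (N ε ω) (h i) with hV
  have hVm : ∀ ε, 0 < ε → AEMeasurable (V ε) (P ε) := fun ε hε =>
    (WithLp.measurable_toLp 2 _).comp_aemeasurable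
      (aemeasurable_pi_lambda _ fun i => (hh i).aemeasurable_fluctuation (hN ε hε))
  set γ : Measure (ι → ℝ) := Measure.pi fun i => gaussianReal 0 (∫ p, h i p ^ 2 ∂μ).toNNReal with hγ
  have hγp : IsProbabilityMeasure (γ.map (WithLp.toLp 2)) :=
    Measure.isProbabilityMeasure_map (WithLp.measurable_toLp 2 _).aemeasurable
  set Ψ : EuclideanSpace ℝ ι →ᵇ ℝ := Φ.compContinuous ⟨_, PiLp.continuous_ofLp 2 _⟩ with hΨ
  -- Lévy's continuity theorem is applied along sequences `x n ↓ 0`.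
  refine tendsto_of_seq_tendsto fun x hx => ?_
  have hpos : ∀ᶠ n in atTop, 0 < x n := hx.eventually self_mem_nhdsWithin
  classical
  -- Nothing is known for nonpositive `ε`; the limit law fills in at the finitely many such indices.
  let κ : ℕ → ProbabilityMeasure (EuclideanSpace ℝ ι) := fun n =>
    if hn : 0 < x n then ⟨(P (x n)).map (V (x n)), Measure.isProbabilityMeasure_map (hVm _ hn)⟩
    else ⟨γ.map (WithLp.toLp 2), hγp⟩
  have hκ : ∀ n, 0 < x n → ((κ n : ProbabilityMeasure _) : Measure (EuclideanSpace ℝ ι))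
      = (P (x n)).map (V (x n)) := fun n hn => by
    rw [show κ n = ⟨_, Measure.isProbabilityMeasure_map (hVm _ hn)⟩ from dif_pos hn]
    rfl
  have hconv : Tendsto κ atTop (𝓝 ⟨γ.map (WithLp.toLp 2), hγp⟩) := by
    refine ProbabilityMeasure.tendsto_of_tendsto_charFun fun t => ?_
    have hlim : ∀ i, Tendsto (fun n => Complex.exp (((x n)⁻¹ : ℝ)
        * ∫ p, compExp (√(x n)) (t i * h i p) ∂μ)) atTop
        (𝓝 (charFun (gaussianReal 0 (∫ p, h i p ^ 2 ∂μ).toNNReal) (t i))) := by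
      intro i
      have h1 := (((hh i).const_mul (t i)).tendsto_exp_integral_compExp).comp hx
      convert! h1 using 2
      rw [charFun_gaussianReal, Real.coe_toNNReal _ (integral_nonneg fun p => sq_nonneg _)]
      simp_rw [mul_pow, integral_const_mul]
      push_cast
      ring_nf
    have h2 := tendsto_finsetProd Finset.univ fun i _ => hlim i
    rw [← charFun_pi] at h2
    refine h2.congr' ?_
    filter_upwards [hpos] with n hn
    rw [hκ n hn]
    have h3 := (iIndepFun_iff_charFun_pi
      (fun i => (hh i).aemeasurable_fluctuation (hN _ hn))).1
      (iIndepFun_fluctuation hn (hN _ hn) hh hd) t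
    rw [h3]
    exact Finset.prod_congr rfl fun i _ => ((hh i).charFun_fluctuation hn (hN _ hn) (t i)).symm
  have h4 := (ProbabilityMeasure.tendsto_iff_forall_integral_tendsto.1 hconv) Ψ
  have h5 : ∫ y, Ψ y ∂(γ.map (WithLp.toLp 2)) = ∫ y, Φ y ∂γ := by
    rw [integral_map (WithLp.measurable_toLp 2 _).aemeasurable Ψ.continuous.aestronglyMeasurable]
    rfl
  change Tendsto _ _ (𝓝 (∫ y, Ψ y ∂(γ.map (WithLp.toLp 2)))) at h4
  rw [h5] at h4
  refine h4.congr' ?_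
  filter_upwards [hpos] with n hn
  rw [hκ n hn, integral_map (hVm _ hn) Ψ.continuous.aestronglyMeasurable]
  rfl

/-- The truncated fourth power `min 1 ((x / δ) ^ 4)`. -/
def truncFourth (δ : ℝ) : ℝ →ᵇ ℝ :=
  BoundedContinuousFunction.ofNormedAddCommGroup (fun x => min 1 ((x / δ) ^ 4)) (by fun_prop) 1
    (fun x => by
      rw [Real.norm_of_nonneg (le_min zero_le_one (by positivity))]
      exact min_le_left _ _)

lemma truncFourth_apply (δ x : ℝ) : truncFourth δ x = min 1 ((x / δ) ^ 4) := rfl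

lemma one_le_truncFourth {δ x : ℝ} (hδ : 0 < δ) (hx : δ < |x|) : 1 ≤ truncFourth δ x := by
  rw [truncFourth_apply]
  refine le_min le_rfl ?_
  have h1 : 1 ≤ |x / δ| := by
    rw [abs_div, abs_of_pos hδ, le_div_iff₀ hδ]
    linarith
  calc (1 : ℝ) = 1 ^ 4 := by norm_num
    _ ≤ |x / δ| ^ 4 := by gcongr
    _ = _ := by rw [show (4 : ℕ) = 2 * 2 from rfl, pow_mul, sq_abs, pow_mul]

/-- Drop the truncation and scale by `√v`. The truncation is there only so that convergence in law
applies to a bounded continuous function dominating the indicator of `{|x| > δ}`. -/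
lemma integral_truncFourth_gaussianReal_le (δ : ℝ) (v : ℝ≥0) :
    ∫ x, truncFourth δ x ∂(gaussianReal 0 v)
      ≤ (∫ x, x ^ 4 ∂(gaussianReal 0 1)) * v ^ 2 / δ ^ 4 := by
  have h4 : Integrable (fun x : ℝ => x ^ 4) (gaussianReal 0 1) := by
    have := (memLp_id_gaussianReal (μ := 0) (v := 1) 4).integrable_norm_pow (p := 4) (by norm_num)
    refine this.congr (Eventually.of_forall fun x => ?_)
    simp only [id, Real.norm_eq_abs]
    rw [show (4 : ℕ) = 2 * 2 from rfl, pow_mul, sq_abs, pow_mul]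
  have h1 : gaussianReal 0 v = (gaussianReal 0 1).map (fun x => √v * x) := by
    rw [gaussianReal_map_const_mul]
    congr 1
    · simp
    · ext
      simp
  rw [h1, integral_map (by fun_prop) (truncFourth δ).continuous.aestronglyMeasurable]
  have hs : √(v : ℝ) ^ 4 = v ^ 2 := by
    rw [show (4 : ℕ) = 2 * 2 from rfl, pow_mul, Real.sq_sqrt (NNReal.coe_nonneg v)]
  have h2 : ∀ x : ℝ, (√v * x / δ) ^ 4 = (v ^ 2 / δ ^ 4) * x ^ 4 := by
    intro x
    rw [div_pow, mul_pow, hs]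
    ring
  calc ∫ x, truncFourth δ (√v * x) ∂(gaussianReal 0 1)
      ≤ ∫ x, ((v : ℝ) ^ 2 / δ ^ 4) * x ^ 4 ∂(gaussianReal 0 1) := by
        refine integral_mono_of_nonneg (Eventually.of_forall fun x => ?_) (h4.const_mul _)
          (Eventually.of_forall fun x => ?_)
        · exact le_min zero_le_one (by positivity)
        · simp only [truncFourth_apply]
          rw [h2]
          exact min_le_right _ _
    _ = _ := by rw [integral_const_mul]; ring

/-- The limit superior of the tail of a fluctuation is of the order of the squared variance. -/
lemma IsFinSq.eventually_measureReal_fluctuation_gt_le {h : MarkedLine → ℝ}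
    (hN : ∀ ε : ℝ, 0 < ε → IsPoissonProcess (P ε) (N ε) (ENNReal.ofReal ε⁻¹ • μ))
    (hh : IsFinSq μ h) {δ η : ℝ} (hδ : 0 < δ) (hη : 0 < η) :
    ∀ᶠ ε in 𝓝[>] 0, (P ε).real {ω | δ < |fluctuation μ ε (N ε ω) h|}
      ≤ (∫ x, x ^ 4 ∂(gaussianReal 0 1)) * (∫ p, h p ^ 2 ∂μ) ^ 2 / δ ^ 4 + η := by
  have hσ0 : 0 ≤ ∫ p, h p ^ 2 ∂μ := integral_nonneg fun p => sq_nonneg _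
  have h1 := tendsto_integral_fluctuation (ι := Unit) (h := fun _ => h) hN (fun _ => hh)
    (fun i j hij => (hij (Subsingleton.elim i j)).elim)
    ((truncFourth δ).compContinuous ⟨fun x => x (), by fun_prop⟩)
  have h2 : ∫ x : Unit → ℝ, truncFourth δ (x ())
      ∂(Measure.pi fun _ : Unit => gaussianReal 0 (∫ p, h p ^ 2 ∂μ).toNNReal)
      = ∫ x, truncFourth δ x ∂(gaussianReal 0 (∫ p, h p ^ 2 ∂μ).toNNReal) :=
    (measurePreserving_eval (fun _ : Unit => gaussianReal 0 (∫ p, h p ^ 2 ∂μ).toNNReal)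
      ()).integral_comp' (f := MeasurableEquiv.funUnique Unit ℝ) _
  simp only [BoundedContinuousFunction.compContinuous_apply, ContinuousMap.coe_mk] at h1
  rw [h2] at h1
  have h3 := integral_truncFourth_gaussianReal_le δ (∫ p, h p ^ 2 ∂μ).toNNReal
  rw [Real.coe_toNNReal _ hσ0] at h3
  filter_upwards [h1.eventually_le_const (lt_of_le_of_lt h3 (lt_add_of_pos_right _ hη)),
    self_mem_nhdsWithin] with ε hε hpos
  refine le_trans ?_ hε
  have hm := hh.aemeasurable_fluctuation (hN ε hpos)
  have hi : Integrable (fun ω => truncFourth δ (fluctuation μ ε (N ε ω) h)) (P ε) := by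
    exact (integrable_const ‖truncFourth δ‖).mono'
      ((truncFourth δ).continuous.comp_aestronglyMeasurable hm.aestronglyMeasurable)
      (Eventually.of_forall fun ω => (truncFourth δ).norm_coe_le_norm _)
  have h4 := mul_meas_ge_le_integral_of_nonneg
    (Eventually.of_forall fun ω => le_min zero_le_one (by positivity)) hi 1
  rw [one_mul] at h4
  exact (measureReal_mono fun ω hω => one_le_truncFourth hδ hω).trans h4

end Limit

end HardRods

namespace HardRods

/-! ### A maximal inequality -/

section Ottaviani

variable {Ω : Type*} [MeasurableSpace Ω] {P : Measure Ω} [IsProbabilityMeasure P]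

/-- Decompose by the first index `k` at which the partial sum exceeds `2δ`. This event `A k` is
independent of the event `B k` that the remaining sum is at most `δ`, and `B k` has probability at
least `1/2`. On `A k ∩ B k` the full sum exceeds `δ`, and these events are disjoint. -/
lemma ottaviani_of_measurable {X : ℕ → Ω → ℝ} (hX : ∀ i, Measurable (X i)) (hind : iIndepFun X P)
    {l : ℕ} {δ : ℝ}
    (hs : ∀ k ≤ l, P.real {ω | δ < |∑ i ∈ Finset.Ico k l, X i ω|} ≤ 1 / 2) :
    P.real {ω | ∃ k ≤ l, 2 * δ < |∑ i ∈ Finset.range k, X i ω|}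
      ≤ 2 * P.real {ω | δ < |∑ i ∈ Finset.range l, X i ω|} := by
  set T : ℕ → Set (ℕ → ℝ) := fun k => {x | 2 * δ < |∑ i ∈ Finset.range k, x i| ∧
    ∀ j < k, |∑ i ∈ Finset.range j, x i| ≤ 2 * δ} with hT
  have hTm : ∀ k, MeasurableSet (T k) := by
    intro k
    have h1 : MeasurableSet {x : ℕ → ℝ | 2 * δ < |∑ i ∈ Finset.range k, x i|} :=
      measurableSet_lt measurable_const (by fun_prop)
    refine h1.inter ?_
    have : {x : ℕ → ℝ | ∀ j < k, |∑ i ∈ Finset.range j, x i| ≤ 2 * δ}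
        = ⋂ j, ⋂ (_ : j < k), {x : ℕ → ℝ | |∑ i ∈ Finset.range j, x i| ≤ 2 * δ} := by
      ext; simp
    change MeasurableSet {x : ℕ → ℝ | ∀ j < k, |∑ i ∈ Finset.range j, x i| ≤ 2 * δ}
    rw [this]
    exact MeasurableSet.iInter fun j => MeasurableSet.iInter fun _ =>
      measurableSet_le (by fun_prop) measurable_const
  set A : ℕ → Set Ω := fun k => {ω | (fun i => X i ω) ∈ T k} with hA
  have hAm : ∀ k, MeasurableSet (A k) := fun k => measurable_pi_lambda _ hX (hTm k)
  set B : ℕ → Set Ω := fun k => {ω | |∑ i ∈ Finset.Ico k l, X i ω| ≤ δ} with hB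
  have hBm : ∀ k, MeasurableSet (B k) := fun k =>
    measurableSet_le (by fun_prop) measurable_const
  have hdisj : Pairwise (Function.onFun Disjoint A) := by
    intro j k hjk
    rw [Function.onFun, Set.disjoint_left]
    rintro ω ⟨h1, h2⟩ ⟨h3, h4⟩
    rcases lt_or_gt_of_ne hjk with h | h
    · exact absurd (h4 j h) (not_le.2 h1)
    · exact absurd (h2 k h) (not_le.2 h3)
  have hcover : {ω | ∃ k ≤ l, 2 * δ < |∑ i ∈ Finset.range k, X i ω|}
      ⊆ ⋃ k ∈ Finset.range (l + 1), A k := by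
    rintro ω ⟨k, hk, hω⟩
    classical
    have hex : ∃ k, 2 * δ < |∑ i ∈ Finset.range k, X i ω| := ⟨k, hω⟩
    simp only [Set.mem_iUnion, Finset.mem_range]
    exact ⟨Nat.find hex, by have := Nat.find_min' hex hω; omega, Nat.find_spec hex,
      fun j hj => not_lt.1 (Nat.find_min hex hj)⟩
  have hindep : ∀ k ≤ l, P.real (A k) ≤ 2 * P.real (A k ∩ B k) := by
    intro k hk
    have h1 := hind.indepFun_finset (Finset.range k) (Finset.Ico k l) (by
      rw [Finset.disjoint_left]; intro i; simp; omega) hX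
    -- Extending by zero exhibits `A k` as an event of the first `k` variables, since `T k` ignores
    -- the other coordinates.
    set φ : (Finset.range k → ℝ) → ℕ → ℝ :=
      fun x i => if hi : i ∈ Finset.range k then x ⟨i, hi⟩ else 0 with hφ
    have hφm : Measurable φ := by
      refine measurable_pi_lambda _ fun i => ?_
      by_cases hi : i ∈ Finset.range k
      · simp only [hφ, hi, dif_pos]; fun_prop
      · simp only [hφ, hi, dif_neg, not_false_iff]; fun_prop
    have h2 := h1.comp hφm (by fun_prop : Measurable fun x : Finset.Ico k l → ℝ => ∑ i, x i)
    have h3 := h2.measure_inter_preimage_eq_mul (T k) {x | |x| ≤ δ} (hTm k)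
      (measurableSet_le (by fun_prop) measurable_const)
    have hA' : (φ ∘ fun ω (i : Finset.range k) => X i ω) ⁻¹' (T k) = A k := by
      ext ω
      have hsum : ∀ j ≤ k, ∑ i ∈ Finset.range j, φ (fun i : Finset.range k => X i ω) i
          = ∑ i ∈ Finset.range j, X i ω := by
        intro j hj
        refine Finset.sum_congr rfl fun i hi => ?_
        have : i ∈ Finset.range k := Finset.mem_range.2 ((Finset.mem_range.1 hi).trans_le hj)
        simp only [hφ, this, dif_pos]
      simp only [hA, hT, Set.mem_preimage, Function.comp_apply, Set.mem_ofPred_eq]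
      rw [hsum k le_rfl]
      refine and_congr_right fun _ => forall₂_congr fun j hj => ?_
      rw [hsum j hj.le]
    have hB' : ((fun x : Finset.Ico k l → ℝ => ∑ i, x i) ∘ fun ω (i : Finset.Ico k l) => X i ω) ⁻¹'
        {x | |x| ≤ δ} = B k := by
      ext ω
      simp only [hB, Set.mem_preimage, Function.comp_apply, Set.mem_ofPred_eq]
      rw [Finset.sum_coe_sort (Finset.Ico k l) fun i => X i ω]
    rw [hA', hB'] at h3
    have h4 : P.real (A k ∩ B k) = P.real (A k) * P.real (B k) := by
      simp only [measureReal_def, h3, ENNReal.toReal_mul]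
    have h5 : 1 / 2 ≤ P.real (B k) := by
      have h6 := hs k hk
      have h7 : {ω | δ < |∑ i ∈ Finset.Ico k l, X i ω|} = (B k)ᶜ := by
        ext ω; simp [hB]
      rw [h7, probReal_compl_eq_one_sub (hBm k)] at h6
      linarith
    rw [h4]
    nlinarith [measureReal_nonneg (μ := P) (s := A k)]
  calc P.real {ω | ∃ k ≤ l, 2 * δ < |∑ i ∈ Finset.range k, X i ω|}
      ≤ P.real (⋃ k ∈ Finset.range (l + 1), A k) := measureReal_mono hcover (measure_ne_top _ _)
    _ ≤ ∑ k ∈ Finset.range (l + 1), P.real (A k) := measureReal_biUnion_finset_le _ _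
    _ ≤ ∑ k ∈ Finset.range (l + 1), 2 * P.real (A k ∩ B k) := by
        refine Finset.sum_le_sum fun k hk => hindep k ?_
        simp at hk; omega
    _ = 2 * P.real (⋃ k ∈ Finset.range (l + 1), A k ∩ B k) := by
        rw [← Finset.mul_sum, measureReal_biUnion_finset]
        · intro j _ k _ hjk
          exact (hdisj hjk).mono Set.inter_subset_left Set.inter_subset_left
        · exact fun k _ => (hAm k).inter (hBm k)
    _ ≤ 2 * P.real {ω | δ < |∑ i ∈ Finset.range l, X i ω|} := by
        gcongr
        · exact measure_ne_top _ _
        intro ω hω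
        simp only [Set.mem_iUnion, Finset.mem_range] at hω
        obtain ⟨k, hk, ⟨h1, -⟩, h2⟩ := hω
        simp only [hB, Set.mem_ofPred_eq] at h1 h2 ⊢
        have h3 := Finset.sum_range_add_sum_Ico (fun i => X i ω) (show k ≤ l by omega)
        have h4 := abs_sub_abs_le_abs_sub (∑ i ∈ Finset.range k, X i ω)
          (-∑ i ∈ Finset.Ico k l, X i ω)
        rw [abs_neg, sub_neg_eq_add, h3] at h4
        linarith

/-- **Ottaviani's inequality**. -/
lemma ottaviani {X : ℕ → Ω → ℝ} (hX : ∀ i, AEMeasurable (X i) P) (hind : iIndepFun X P)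
    {l : ℕ} {δ : ℝ}
    (hs : ∀ k ≤ l, P.real {ω | δ < |∑ i ∈ Finset.Ico k l, X i ω|} ≤ 1 / 2) :
    P.real {ω | ∃ k ≤ l, 2 * δ < |∑ i ∈ Finset.range k, X i ω|}
      ≤ 2 * P.real {ω | δ < |∑ i ∈ Finset.range l, X i ω|} := by
  have hae : ∀ᵐ ω ∂P, ∀ i, X i ω = (hX i).mk _ ω := ae_all_iff.2 fun i => (hX i).ae_eq_mk
  have key := ottaviani_of_measurable (P := P) (l := l) (δ := δ) (fun i => (hX i).measurable_mk)
    (hind.congr fun i => (hX i).ae_eq_mk) (fun k hk => by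
      refine le_of_eq_of_le (measureReal_congr (eventuallyEq_set.2 ?_)) (hs k hk)
      filter_upwards [hae] with ω hω
      simp only [hω])
  refine le_of_eq_of_le (measureReal_congr (eventuallyEq_set.2 ?_))
    (key.trans_eq (congrArg _ (measureReal_congr (eventuallyEq_set.2 ?_))))
  all_goals
    filter_upwards [hae] with ω hω
    simp only [hω]

end Ottaviani

end HardRods

namespace HardRods

/-! ### Fluctuations along an increasing family of sets -/

/-- The function `c (1_{J b} - 1_{J a})`. -/
def increment (c : MarkedLine → ℝ) (J : ℝ → Set MarkedLine) (a b : ℝ) (p : MarkedLine) : ℝ :=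
  c p * ((J b).indicator 1 p - (J a).indicator 1 p)

/-- An increasing family of measurable sets that is continuous from one side. -/
structure IsSweep (J : ℝ → Set MarkedLine) : Prop where
  mono : Monotone J
  measurableSet : ∀ t, MeasurableSet (J t)
  oneSided : (∀ t, ∀ p ∉ J t, ∃ t' > t, p ∉ J t') ∨ (∀ t, ∀ p ∈ J t, ∃ t' < t, p ∈ J t')

variable {c : MarkedLine → ℝ} {J : ℝ → Set MarkedLine} {μ : Measure MarkedLine}

lemma sum_Ico_increment (q : ℕ → ℝ) {k l : ℕ} (hkl : k ≤ l) (p : MarkedLine) :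
    ∑ i ∈ Finset.Ico k l, increment c J (q i) (q (i + 1)) p = increment c J (q k) (q l) p := by
  simp only [increment, ← Finset.mul_sum]
  rw [Finset.sum_Ico_sub (fun i => (J (q i)).indicator (1 : MarkedLine → ℝ) p) hkl]

lemma IsSweep.increment_of_le (hJ : IsSweep J) {a b : ℝ} (hab : a ≤ b) :
    increment c J a b = (J b \ J a).indicator c := by
  ext p
  have := @hJ.mono a b hab p
  by_cases ha : p ∈ J a <;> by_cases hb : p ∈ J b <;> simp_all [increment]

/-- Inner increments are restrictions of the outer one; this passes integrability and bounds on to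
subintervals. -/
lemma IsSweep.increment_eq_indicator (hJ : IsSweep J) {s a b u : ℝ} (hsa : s ≤ a) (hab : a ≤ b)
    (hbu : b ≤ u) : increment c J a b = (J b \ J a).indicator (increment c J s u) := by
  rw [hJ.increment_of_le hab, hJ.increment_of_le (hsa.trans (hab.trans hbu)),
    Set.indicator_indicator, Set.inter_eq_left.2]
  exact Set.sdiff_subset_sdiff (hJ.mono hbu) (hJ.mono hsa)

lemma IsSweep.isFinSq_increment (hJ : IsSweep J) {s a b u : ℝ} (hsa : s ≤ a) (hab : a ≤ b)
    (hbu : b ≤ u) (h : IsFinSq μ (increment c J s u)) : IsFinSq μ (increment c J a b) := by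
  rw [hJ.increment_eq_indicator hsa hab hbu]
  exact h.indicator ((hJ.measurableSet b).diff (hJ.measurableSet a))

lemma IsSweep.abs_increment_le (hJ : IsSweep J) {s a b u : ℝ} (hsa : s ≤ a) (hab : a ≤ b)
    (hbu : b ≤ u) (p : MarkedLine) : |increment c J a b p| ≤ |increment c J s u p| := by
  rw [hJ.increment_eq_indicator hsa hab hbu]
  by_cases hp : p ∈ J b \ J a <;> simp [hp]

lemma IsSweep.increment_disjoint (hJ : IsSweep J) {a b a' b' : ℝ} (hab : a ≤ b) (hba : b ≤ a')
    (hab' : a' ≤ b') (p : MarkedLine) :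
    increment c J a b p = 0 ∨ increment c J a' b' p = 0 := by
  rw [hJ.increment_of_le hab, hJ.increment_of_le hab']
  by_cases hp : p ∈ J b
  · right
    exact Set.indicator_of_notMem (fun h => h.2 (hJ.mono hba hp)) _
  · left
    exact Set.indicator_of_notMem (fun h => hp h.1) _

/-- The `k`-th point of the grid that divides `[s, u]` into `2 ^ m` equal parts. -/
def dyadicPoint (s u : ℝ) (m k : ℕ) : ℝ := s + (u - s) * (min (k : ℝ) (2 ^ m) / 2 ^ m)

lemma dyadicPoint_mono {s u : ℝ} (hsu : s ≤ u) (m : ℕ) : Monotone (dyadicPoint s u m) := by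
  intro k l hkl
  have : 0 ≤ u - s := sub_nonneg.2 hsu
  unfold dyadicPoint
  gcongr

lemma dyadicPoint_zero (s u : ℝ) (m : ℕ) : dyadicPoint s u m 0 = s := by
  simp [dyadicPoint]

lemma dyadicPoint_of_le {s u : ℝ} {m k : ℕ} (hk : k ≤ 2 ^ m) :
    dyadicPoint s u m k = s + (u - s) * (k / 2 ^ m) := by
  have : (k : ℝ) ≤ 2 ^ m := by exact_mod_cast hk
  rw [dyadicPoint, min_eq_left this]

lemma dyadicPoint_last (s u : ℝ) (m : ℕ) : dyadicPoint s u m (2 ^ m) = u := by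
  rw [dyadicPoint_of_le le_rfl]
  simp

lemma dyadicPoint_mem {s u : ℝ} (hsu : s ≤ u) (m k : ℕ) : dyadicPoint s u m k ∈ Set.Icc s u := by
  have h0 : 0 ≤ u - s := sub_nonneg.2 hsu
  have h1 : (min (k : ℝ) (2 ^ m) / 2 ^ m) ≤ 1 := by
    rw [div_le_one (by positivity)]; exact min_le_right _ _
  have h2 : 0 ≤ (min (k : ℝ) (2 ^ m) / 2 ^ m) := by positivity
  constructor
  · unfold dyadicPoint; nlinarith
  · unfold dyadicPoint; nlinarith

lemma tendsto_two_pow_cast : Tendsto (fun m : ℕ => (2 : ℝ) ^ m) atTop atTop :=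
  tendsto_pow_atTop_atTop_of_one_lt one_lt_two

/-- Approach `t` from the side on which the family is continuous, by rounding up or down.
Monotonicity settles one implication at once, and one-sidedness the other for large `m`, depending
on `p`. -/
lemma IsSweep.exists_dyadicPoint (hJ : IsSweep J) {s u t : ℝ} (ht : t ∈ Set.Icc s u) :
    ∃ k : ℕ → ℕ, (∀ m, k m ≤ 2 ^ m) ∧
      ∀ p, ∀ᶠ m in atTop, (p ∈ J (dyadicPoint s u m (k m)) ↔ p ∈ J t) := by
  have hsu : 0 ≤ u - s := by linarith [ht.1, ht.2]
  obtain ⟨x, hx0, hx1, rfl⟩ : ∃ x : ℝ, 0 ≤ x ∧ x ≤ 1 ∧ t = s + (u - s) * x := by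
    rcases hsu.eq_or_lt with h | h
    · exact ⟨0, le_rfl, zero_le_one, by linarith [ht.1, ht.2]⟩
    · refine ⟨(t - s) / (u - s), div_nonneg (by linarith [ht.1]) hsu, ?_, by field_simp; ring⟩
      rw [div_le_one h]; linarith [ht.2]
  have hlim : ∀ r : ℝ → ℕ, Tendsto (fun y : ℝ => (r (x * y) : ℝ) / y) atTop (𝓝 x) →
      Tendsto (fun m : ℕ => s + (u - s) * ((r (x * 2 ^ m) : ℝ) / 2 ^ m)) atTop
        (𝓝 (s + (u - s) * x)) := fun r hr =>
    ((hr.comp tendsto_two_pow_cast).const_mul _).const_add _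
  rcases hJ.oneSided with hr | hl
  · have hk : ∀ m : ℕ, ⌈x * 2 ^ m⌉₊ ≤ 2 ^ m := by
      intro m
      rw [Nat.ceil_le]
      push_cast
      exact mul_le_of_le_one_left (by positivity) hx1
    refine ⟨fun m => ⌈x * 2 ^ m⌉₊, hk, fun p => ?_⟩
    have hge : ∀ m : ℕ, s + (u - s) * x ≤ s + (u - s) * ((⌈x * 2 ^ m⌉₊ : ℝ) / 2 ^ m) := by
      intro m
      gcongr
      rw [le_div_iff₀ (by positivity)]
      exact Nat.le_ceil _
    by_cases hp : p ∈ J (s + (u - s) * x)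
    · refine Eventually.of_forall fun m => ⟨fun _ => hp, fun _ => ?_⟩
      rw [dyadicPoint_of_le (hk m)]
      exact hJ.mono (hge m) hp
    · obtain ⟨t', ht', hpt⟩ := hr _ p hp
      filter_upwards [(hlim Nat.ceil (tendsto_nat_ceil_mul_div_atTop hx0)).eventually_lt_const ht']
        with m hm
      refine ⟨fun h => absurd ?_ hpt, fun h => absurd h hp⟩
      rw [dyadicPoint_of_le (hk m)] at h
      exact hJ.mono hm.le h
  · have hk : ∀ m : ℕ, ⌊x * 2 ^ m⌋₊ ≤ 2 ^ m := by
      intro m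
      have : (⌊x * 2 ^ m⌋₊ : ℝ) ≤ 2 ^ m :=
        (Nat.floor_le (by positivity)).trans (mul_le_of_le_one_left (by positivity) hx1)
      exact_mod_cast this
    refine ⟨fun m => ⌊x * 2 ^ m⌋₊, hk, fun p => ?_⟩
    have hle : ∀ m : ℕ, s + (u - s) * ((⌊x * 2 ^ m⌋₊ : ℝ) / 2 ^ m) ≤ s + (u - s) * x := by
      intro m
      gcongr
      rw [div_le_iff₀ (by positivity)]
      exact Nat.floor_le (by positivity)
    by_cases hp : p ∈ J (s + (u - s) * x)
    · obtain ⟨t', ht', hpt⟩ := hl _ p hp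
      filter_upwards [(hlim Nat.floor
        (tendsto_nat_floor_mul_div_atTop hx0)).eventually_const_lt ht'] with m hm
      refine ⟨fun _ => hp, fun _ => ?_⟩
      rw [dyadicPoint_of_le (hk m)]
      exact hJ.mono hm.le hpt
    · refine Eventually.of_forall fun m => ⟨fun h => ?_, fun h => absurd h hp⟩
      rw [dyadicPoint_of_le (hk m)] at h
      exact hJ.mono (hle m) h

lemma IsSweep.tendsto_integral_increment (hJ : IsSweep J) {s u t : ℝ}
    (hc : Measurable c)
    {κ : Measure MarkedLine} (hκ : Integrable (increment c J s u) κ) {q : ℕ → ℝ}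
    (hq : ∀ m, q m ∈ Set.Icc s u) (hlim : ∀ p, ∀ᶠ m in atTop, (p ∈ J (q m) ↔ p ∈ J t)) :
    Tendsto (fun m => ∫ p, increment c J s (q m) p ∂κ) atTop
      (𝓝 (∫ p, increment c J s t p ∂κ)) := by
  refine tendsto_integral_of_dominated_convergence (fun p => |increment c J s u p|) (fun m => ?_)
    hκ.abs (fun m => Eventually.of_forall fun p => ?_) (Eventually.of_forall fun p => ?_)
  · rw [hJ.increment_of_le (hq m).1]
    exact (hc.indicator ((hJ.measurableSet _).diff (hJ.measurableSet _))).aestronglyMeasurable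
  · exact hJ.abs_increment_le le_rfl (hq m).1 (hq m).2 p
  · refine tendsto_const_nhds.congr' ?_
    filter_upwards [hlim p] with m hm
    simp only [increment]
    congr 2
    by_cases hp : p ∈ J t <;> simp [hp, hm]

section Maximal

variable {Ω : Type*} [MeasurableSpace Ω] {P : Measure Ω} [IsProbabilityMeasure P]
  {N : Ω → Measure MarkedLine} {ε : ℝ}

/-- Increments over the cells have disjoint supports, hence independent fluctuations. Each tail sum
is the fluctuation of an inner increment, whose variance is at most that of the whole, so `hσ` gives
Ottaviani's `1/2`. -/
lemma IsSweep.measureReal_exists_dyadicPoint_le (hJ : IsSweep J) (hε : 0 < ε)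
    (hN : IsPoissonProcess P N (ENNReal.ofReal ε⁻¹ • μ)) {s u : ℝ} (hsu : s ≤ u)
    (hh : IsFinSq μ (increment c J s u)) {δ : ℝ} (hδ : 0 < δ)
    (hσ : 48 * (∫ p, increment c J s u p ^ 2 ∂μ) / δ ^ 2 ≤ 1 / 2) (m : ℕ) :
    P.real {ω | ∃ k ≤ 2 ^ m,
        2 * δ < |fluctuation μ ε (N ω) (increment c J s (dyadicPoint s u m k))|}
      ≤ 2 * P.real {ω | δ < |fluctuation μ ε (N ω) (increment c J s u)|} := by
  set q := dyadicPoint s u m with hq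
  have hqm := dyadicPoint_mono hsu m
  have hqI := dyadicPoint_mem hsu m
  set h : ℕ → MarkedLine → ℝ := fun i => increment c J (q i) (q (i + 1)) with hhdef
  have hF : ∀ {k l}, k ≤ l → IsFinSq μ (increment c J (q k) (q l)) := fun hkl =>
    hJ.isFinSq_increment (hqI _).1 (hqm hkl) (hqI _).2 hh
  have hF1 : ∀ i, IsFinSq μ (h i) := fun i => hF (Nat.le_succ i)
  have hind := iIndepFun_fluctuation (h := h) hε hN hF1 (by
    intro i j hij p
    rcases lt_or_gt_of_ne hij with h | h
    · exact hJ.increment_disjoint (hqm (Nat.le_succ i)) (hqm h) (hqm (Nat.le_succ j)) p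
    · exact (hJ.increment_disjoint (hqm (Nat.le_succ j)) (hqm h) (hqm (Nat.le_succ i)) p).symm)
  have hsum : ∀ᵐ ω ∂P, ∀ k l, k ≤ l → ∑ i ∈ Finset.Ico k l, fluctuation μ ε (N ω) (h i)
      = fluctuation μ ε (N ω) (increment c J (q k) (q l)) := by
    have : ∀ᵐ ω ∂P, ∀ i, Integrable (h i) (N ω) :=
      ae_all_iff.2 fun i => (hF1 i).ae_integrable hN
    filter_upwards [this] with ω hω k l hkl
    rw [← fluctuation_sum _ (fun i _ => (hF1 i).integrable) (fun i _ => hω i)]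
    congr 1
    ext p
    exact sum_Ico_increment q hkl p
  have key := ottaviani (X := fun i ω => fluctuation μ ε (N ω) (h i)) (P := P) (δ := δ) (l := 2 ^ m)
    (fun i => (hF1 i).aemeasurable_fluctuation hN) hind (by
      intro k hk
      refine le_trans (le_of_eq_of_le (measureReal_congr (eventuallyEq_set.2 ?_))
        ((hF hk).measureReal_fluctuation_gt_le hε hN hδ)) (le_trans ?_ hσ)
      · filter_upwards [hsum] with ω hω
        simp only [hω k _ hk]
      · gcongr ?_ * ?_ / ?_
        refine integral_mono (hF hk).sq hh.sq fun p => ?_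
        exact sq_le_sq.2 (hJ.abs_increment_le (hqI _).1 (hqm hk) (hqI _).2 p))
  refine le_of_eq_of_le (measureReal_congr (eventuallyEq_set.2 ?_))
    (key.trans_eq (congrArg _ (measureReal_congr (eventuallyEq_set.2 ?_))))
  · filter_upwards [hsum] with ω hω
    simp only [Finset.range_eq_Ico, hω 0 _ (Nat.zero_le _)]
    simp only [hq, dyadicPoint_zero]
  · filter_upwards [hsum] with ω hω
    simp only [Finset.range_eq_Ico, hω 0 _ (Nat.zero_le _)]
    simp only [hq, dyadicPoint_zero, dyadicPoint_last]

/-- The dyadic events increase with `m` and obey a bound free of `m`. A strict exceedance at an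
arbitrary `t` is inherited by nearby dyadic points, almost surely, so the uncountable union is
covered without being shown measurable. -/
lemma IsSweep.measureReal_exists_gt_le (hJ : IsSweep J) (hc : Measurable c) (hε : 0 < ε)
    (hN : IsPoissonProcess P N (ENNReal.ofReal ε⁻¹ • μ)) {s u : ℝ} (hsu : s ≤ u)
    (hh : IsFinSq μ (increment c J s u)) {δ : ℝ} (hδ : 0 < δ)
    (hσ : 48 * (∫ p, increment c J s u p ^ 2 ∂μ) / δ ^ 2 ≤ 1 / 2) :
    P.real {ω | ∃ t ∈ Set.Icc s u, 2 * δ < |fluctuation μ ε (N ω) (increment c J s t)|}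
      ≤ 2 * P.real {ω | δ < |fluctuation μ ε (N ω) (increment c J s u)|} := by
  set B : ℕ → Set Ω := fun m => {ω | ∃ k ≤ 2 ^ m,
    2 * δ < |fluctuation μ ε (N ω) (increment c J s (dyadicPoint s u m k))|} with hB
  have hmono : Monotone B := by
    refine monotone_nat_of_le_succ fun m ω => ?_
    rintro ⟨k, hk, hω⟩
    have hk2 : 2 * k ≤ 2 ^ (m + 1) := by rw [pow_succ]; omega
    refine ⟨2 * k, hk2, ?_⟩
    have : dyadicPoint s u (m + 1) (2 * k) = dyadicPoint s u m k := by
      rw [dyadicPoint_of_le hk, dyadicPoint_of_le hk2]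
      push_cast
      rw [pow_succ]
      field_simp
    rwa [this]
  have hsub : ({ω | ∃ t ∈ Set.Icc s u,
      2 * δ < |fluctuation μ ε (N ω) (increment c J s t)|} : Set Ω) ≤ᵐ[P] ⋃ m, B m := by
    filter_upwards [hh.ae_integrable hN] with ω hω
    rintro ⟨t, ht, hlt⟩
    obtain ⟨k, hk, hlim⟩ := hJ.exists_dyadicPoint ht
    have h1 := hJ.tendsto_integral_increment hc hω
      (fun m => dyadicPoint_mem hsu m (k m)) hlim
    have h2 := hJ.tendsto_integral_increment hc hh.integrable
      (fun m => dyadicPoint_mem hsu m (k m)) hlim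
    have h3 := (((h1.const_mul ε).sub h2).const_mul (√ε)⁻¹).abs
    obtain ⟨m, hm⟩ := (h3.eventually_const_lt hlt).exists
    exact Set.mem_iUnion.2 ⟨m, k m, hk m, hm⟩
  have hle : P (⋃ m, B m) ≤ ENNReal.ofReal
      (2 * P.real {ω | δ < |fluctuation μ ε (N ω) (increment c J s u)|}) := by
    rw [hmono.measure_iUnion]
    refine iSup_le fun m => ?_
    rw [← ofReal_measureReal]
    exact ENNReal.ofReal_le_ofReal (hJ.measureReal_exists_dyadicPoint_le hε hN hsu hh hδ hσ m)
  exact ENNReal.toReal_le_of_le_ofReal (by positivity) ((measure_mono_ae hsub).trans hle)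

end Maximal

end HardRods

namespace HardRods

/-! ### The path space -/

lemma isCompact_Icc_natCast (n : ℕ) : Set.Icc (-(n : ℝ)) n ∈ {K : Set ℝ | IsCompact K} :=
  isCompact_Icc

lemma monotone_Icc_natCast : Monotone fun n : ℕ => Set.Icc (-(n : ℝ)) n := fun _ _ h =>
  Set.Icc_subset_Icc (neg_le_neg (Nat.cast_le.2 h)) (Nat.cast_le.2 h)

lemma exists_subset_Icc_natCast (K : Set ℝ) (hK : K ∈ {K : Set ℝ | IsCompact K}) :
    ∃ n : ℕ, K ⊆ Set.Icc (-(n : ℝ)) n := by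
  obtain ⟨r, hr⟩ := (show IsCompact K from hK).isBounded.subset_closedBall 0
  obtain ⟨n, hn⟩ := exists_nat_ge r
  refine ⟨n, fun x hx => ?_⟩
  have := hr hx
  rw [mem_closedBall_zero_iff, Real.norm_eq_abs] at this
  exact abs_le.1 (this.trans hn)

/-- Makes the path space pseudometrizable, as needed for Lipschitz approximation and for
measurability of limits. -/
instance : (uniformity PathSpace).IsCountablyGenerated :=
  UniformOnFun.isCountablyGenerated_uniformity _ isCompact_Icc_natCast monotone_Icc_natCast
    exists_subset_Icc_natCast

lemma hasBasis_uniformity_pathSpace :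
    (uniformity PathSpace).HasBasis (fun i : ℕ × ℝ => 0 < i.2) fun i =>
      {q | ∀ t ∈ Set.Icc (-(i.1 : ℝ)) i.1,
        |UniformOnFun.toFun _ q.1 t - UniformOnFun.toFun _ q.2 t| < i.2} :=
  UniformOnFun.hasBasis_uniformity_of_covering_of_basis _ isCompact_Icc_natCast
    monotone_Icc_natCast.directed_le exists_subset_Icc_natCast Metric.uniformity_basis_dist

lemma exists_abs_sub_le_of_uniformContinuous {F : PathSpace → ℝ} (hF : UniformContinuous F) {η : ℝ}
    (hη : 0 < η) : ∃ R : ℕ, ∃ δ > 0, ∀ f g : ℝ → ℝ,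
      (∀ t ∈ Set.Icc (-(R : ℝ)) R, |f t - g t| < δ) → |F (toPath f) - F (toPath g)| ≤ η := by
  obtain ⟨⟨R, δ⟩, hδ, h⟩ := hasBasis_uniformity_pathSpace.mem_iff.1
    (hF (Metric.dist_mem_uniformity hη))
  refine ⟨R, δ, hδ, fun f g hfg => ?_⟩
  have : (toPath f, toPath g) ∈ {q : PathSpace × PathSpace | dist (F q.1) (F q.2) < η} :=
    h fun t ht => hfg t ht
  exact le_of_lt this

lemma tendsto_toPath {ι : Type*} {l : Filter ι} {f : ι → ℝ → ℝ} {g : ℝ → ℝ}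
    (h : ∀ R : ℕ, ∀ δ > 0, ∀ᶠ i in l, ∀ t ∈ Set.Icc (-(R : ℝ)) R, |g t - f i t| < δ) :
    Tendsto (fun i => toPath (f i)) l (𝓝 (toPath g)) := by
  rw [(nhds_basis_uniformity' hasBasis_uniformity_pathSpace).tendsto_right_iff]
  rintro ⟨R, δ⟩ hδ
  exact h R δ hδ

lemma continuous_toPath_sum {ι : Type*} [Fintype ι] (ρ : ι → ℝ → ℝ) (hρ : ∀ i t, |ρ i t| ≤ 1) :
    Continuous fun u : ι → ℝ => toPath fun t => ∑ i, u i * ρ i t := by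
  rw [continuous_iff_continuousAt]
  intro u
  refine tendsto_toPath fun R δ hδ => ?_
  have h1 : Tendsto (fun v : ι → ℝ => ∑ i, |u i - v i|) (𝓝 u) (𝓝 0) := by
    have : Continuous fun v : ι → ℝ => ∑ i, |u i - v i| := by fun_prop
    simpa using this.tendsto u
  filter_upwards [h1.eventually_lt_const hδ] with v hv t _
  refine lt_of_le_of_lt ?_ hv
  rw [← Finset.sum_sub_distrib]
  refine (Finset.abs_sum_le_sum_abs _ _).trans (Finset.sum_le_sum fun i _ => ?_)
  rw [← sub_mul, abs_mul]
  exact mul_le_of_le_one_right (abs_nonneg _) (hρ i t)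

/-! ### Outer expectations -/

section Outer

variable {Ω : Type*} [MeasurableSpace Ω] {P : Measure Ω} [IsProbabilityMeasure P]

/-- The lower bound on `f` bounds the set of candidate integrals from below; the real `sInf` would
otherwise be the junk value `0`. -/
lemma outerExpectation_le {f g : Ω → ℝ} {M : ℝ} (hf : ∀ ω, M ≤ f ω) (hg : Integrable g P)
    (hfg : ∀ ω, f ω ≤ g ω) : outerExpectation P f ≤ ∫ ω, g ω ∂P := by
  refine csInf_le ⟨M, ?_⟩ ⟨g, hg, hfg, rfl⟩
  rintro c ⟨g', hg', hfg', rfl⟩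
  have := integral_mono (integrable_const M) hg' fun ω => (hf ω).trans (hfg' ω)
  simpa using this

lemma le_outerExpectation {f : Ω → ℝ} {a M : ℝ} (hM : ∀ ω, f ω ≤ M)
    (h : ∀ g : Ω → ℝ, Integrable g P → (∀ ω, f ω ≤ g ω) → a ≤ ∫ ω, g ω ∂P) :
    a ≤ outerExpectation P f := by
  refine le_csInf ⟨_, fun _ => M, integrable_const M, hM, rfl⟩ ?_
  rintro c ⟨g, hg, hfg, rfl⟩
  exact h g hg hfg

lemma outerExpectation_mono {f g : Ω → ℝ} {m M : ℝ} (hf : ∀ ω, m ≤ f ω) (hg : ∀ ω, g ω ≤ M)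
    (hfg : ∀ ω, f ω ≤ g ω) : outerExpectation P f ≤ outerExpectation P g :=
  le_outerExpectation hg fun _ hk hgk => outerExpectation_le hf hk fun ω => (hfg ω).trans (hgk ω)

end Outer

/-! ### Approximation of continuous functions by Lipschitz functions -/

section InfConvolution

variable {X : Type*} [PseudoMetricSpace X]

/-- The largest `m`-Lipschitz function below `F`. -/
def infConv (F : X →ᵇ ℝ) (m : ℕ) (x : X) : ℝ := ⨅ y, F y + m * dist x y

lemma neg_norm_le_add_mul_dist (F : X →ᵇ ℝ) (m : ℕ) (x y : X) : -‖F‖ ≤ F y + m * dist x y := by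
  have h1 := abs_le.1 (F.norm_coe_le_norm y)
  have : 0 ≤ m * dist x y := by positivity
  linarith [h1.1]

lemma infConv_le_add (F : X →ᵇ ℝ) (m : ℕ) (x y : X) : infConv F m x ≤ F y + m * dist x y :=
  ciInf_le ⟨-‖F‖, by rintro _ ⟨z, rfl⟩; exact neg_norm_le_add_mul_dist F m x z⟩ y

lemma infConv_le (F : X →ᵇ ℝ) (m : ℕ) (x : X) : infConv F m x ≤ F x := by
  simpa using infConv_le_add F m x x

lemma le_infConv {F : X →ᵇ ℝ} {m : ℕ} {x : X} {a : ℝ} (h : ∀ y, a ≤ F y + m * dist x y) :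
    a ≤ infConv F m x :=
  haveI : Nonempty X := ⟨x⟩
  le_ciInf h

lemma abs_infConv_le (F : X →ᵇ ℝ) (m : ℕ) (x : X) : |infConv F m x| ≤ ‖F‖ :=
  abs_le.2 ⟨le_infConv fun y => neg_norm_le_add_mul_dist F m x y,
    (infConv_le F m x).trans (abs_le.1 (F.norm_coe_le_norm x)).2⟩

lemma lipschitzWith_infConv (F : X →ᵇ ℝ) (m : ℕ) : LipschitzWith m (infConv F m) := by
  refine LipschitzWith.of_le_add_mul _ fun x y => ?_
  rw [← sub_le_iff_le_add]
  refine le_infConv fun z => ?_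
  rw [sub_le_iff_le_add]
  refine (infConv_le_add F m x z).trans ?_
  have h := mul_le_mul_of_nonneg_left (dist_triangle x y z) (Nat.cast_nonneg (α := ℝ) m)
  push_cast
  linarith

/-- Near `x` continuity keeps `F` above `b`; at distance at least `δ` the penalty outweighs the
oscillation `2 ‖F‖` once `m δ ≥ 2 ‖F‖`. -/
lemma tendsto_infConv (F : X →ᵇ ℝ) (x : X) :
    Tendsto (fun m => infConv F m x) atTop (𝓝 (F x)) := by
  rw [tendsto_order]
  refine ⟨fun a ha => ?_, fun a ha => Eventually.of_forall fun m => (infConv_le F m x).trans_lt ha⟩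
  obtain ⟨b, hab, hb⟩ := exists_between ha
  obtain ⟨δ, hδ, h⟩ := Metric.eventually_nhds_iff.1 (F.continuous.continuousAt.eventually_const_lt hb)
  obtain ⟨m₀, hm₀⟩ := exists_nat_ge (2 * ‖F‖ / δ)
  filter_upwards [eventually_ge_atTop m₀] with m hm
  refine hab.trans_le (le_infConv fun y => ?_)
  have hm0 : (0 : ℝ) ≤ m := by positivity
  rcases lt_or_ge (dist y x) δ with hy | hy
  · have := h hy
    have : 0 ≤ m * dist x y := by positivity
    linarith
  · have h1 : 2 * ‖F‖ ≤ m * δ := by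
      rw [← div_le_iff₀ hδ]
      exact hm₀.trans (by exact_mod_cast hm)
    have h2 : m * δ ≤ m * dist x y := by
      rw [dist_comm]
      gcongr
    have h3 := (abs_le.1 (F.norm_coe_le_norm x)).2
    have h4 := (abs_le.1 (F.norm_coe_le_norm y)).1
    linarith

end InfConvolution

section Reduction

variable {Ω : ℝ → Type*} [∀ ε, MeasurableSpace (Ω ε)] {P : ∀ ε, Measure (Ω ε)}
  [∀ ε, IsProbabilityMeasure (P ε)] {Ω' : Type*} [MeasurableSpace Ω'] {P' : Measure Ω'}
  [IsProbabilityMeasure P']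

/-- Lipschitz minorants converge pointwise to `F`, so dominated convergence under the law of `Y`
alone provides `G`; nothing is required of the approximating processes. -/
lemma exists_uniformContinuous_le (F : PathSpace →ᵇ ℝ) {Y : Ω' → PathSpace}
    (hY : AEStronglyMeasurable Y P') {η : ℝ} (hη : 0 < η) :
    ∃ G : PathSpace →ᵇ ℝ, UniformContinuous G ∧ (∀ x, G x ≤ F x) ∧
      ∫ ω, F (Y ω) ∂P' - η < ∫ ω, G (Y ω) ∂P' := by
  let _ := UniformSpace.pseudoMetricSpace PathSpace
  let G : ℕ → PathSpace →ᵇ ℝ := fun m => BoundedContinuousFunction.ofNormedAddCommGroup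
    (infConv F m) (lipschitzWith_infConv F m).continuous ‖F‖ (abs_infConv_le F m)
  have hlim : Tendsto (fun m => ∫ ω, G m (Y ω) ∂P') atTop (𝓝 (∫ ω, F (Y ω) ∂P')) :=
    tendsto_integral_of_dominated_convergence (fun _ => ‖F‖)
      (fun m => (G m).continuous.comp_aestronglyMeasurable hY) (integrable_const _)
      (fun m => Eventually.of_forall fun ω => abs_infConv_le F m (Y ω))
      (Eventually.of_forall fun ω => tendsto_infConv F (Y ω))
  obtain ⟨m, hm⟩ := (hlim.eventually_const_lt (sub_lt_self _ hη)).exists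
  exact ⟨G m, (lipschitzWith_infConv F m).uniformContinuous, fun x => infConv_le F m x, hm⟩

/-- It suffices to check convergence in law on bounded uniformly continuous functionals. -/
lemma tendsto_outerExpectation_of_uniformContinuous {X : ∀ ε, Ω ε → PathSpace} {Y : Ω' → PathSpace}
    (hY : AEStronglyMeasurable Y P')
    (h : ∀ F : PathSpace →ᵇ ℝ, UniformContinuous F →
      Tendsto (fun ε => outerExpectation (P ε) fun ω => F (X ε ω)) (𝓝[>] 0)
        (𝓝 (∫ ω, F (Y ω) ∂P'))) (F : PathSpace →ᵇ ℝ) :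
    Tendsto (fun ε => outerExpectation (P ε) fun ω => F (X ε ω)) (𝓝[>] 0)
      (𝓝 (∫ ω, F (Y ω) ∂P')) := by
  have hlow : ∀ (G : PathSpace →ᵇ ℝ) x, -‖G‖ ≤ G x := fun G x => (abs_le.1 (G.norm_coe_le_norm x)).1
  have hup : ∀ (G : PathSpace →ᵇ ℝ) x, G x ≤ ‖G‖ := fun G x => (abs_le.1 (G.norm_coe_le_norm x)).2
  rw [tendsto_order]
  constructor
  · intro a ha
    obtain ⟨G, hGu, hGF, hG⟩ := exists_uniformContinuous_le F hY (sub_pos.2 ha)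
    rw [sub_sub_cancel] at hG
    filter_upwards [(h G hGu).eventually_const_lt hG] with ε hε
    exact hε.trans_le (outerExpectation_mono (fun ω => hlow G _) (fun ω => hup F _) fun ω => hGF _)
  · intro a ha
    -- A minorant of `-F` is the negative of a majorant of `F`.
    obtain ⟨G, hGu, hGF, hG⟩ := exists_uniformContinuous_le (-F) hY (sub_pos.2 ha)
    have hG' : ∫ ω, (-G) (Y ω) ∂P' < a := by
      simp only [BoundedContinuousFunction.coe_neg, Pi.neg_apply, integral_neg] at hG ⊢
      linarith
    filter_upwards [(h (-G) hGu.neg).eventually_lt_const hG'] with ε hε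
    refine lt_of_le_of_lt (outerExpectation_mono (fun ω => hlow F _) (fun ω => hup (-G) _)
      fun ω => ?_) hε
    have := hGF (X ε ω)
    simp only [BoundedContinuousFunction.coe_neg, Pi.neg_apply] at this ⊢
    linarith

end Reduction

end HardRods

namespace HardRods

/-! ### Step functions on a grid -/

/-- The `j`-th point of the grid of mesh `1 / (n + 1)` that starts at `-R`. -/
def gridPoint (R n j : ℕ) : ℝ := j / (n + 1) - R

/-- The number of cells of the grid on `[-R, R]`. -/
abbrev gridSize (R n : ℕ) : ℕ := 2 * R * (n + 1)

/-- The index of the last grid point in `[-R, R]` to the left of `t`. -/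
def gridIndex (R n : ℕ) (t : ℝ) : ℕ := min ⌊(t + R) * (n + 1)⌋₊ (gridSize R n)

lemma gridIndex_le (R n : ℕ) (t : ℝ) : gridIndex R n t ≤ gridSize R n := min_le_right _ _

lemma gridPoint_mono (R n : ℕ) : Monotone (gridPoint R n) := by
  intro i j h
  unfold gridPoint
  gcongr

lemma gridPoint_succ_sub (R n j : ℕ) : gridPoint R n (j + 1) - gridPoint R n j = 1 / (n + 1) := by
  unfold gridPoint
  push_cast
  ring

lemma gridPoint_center (R n : ℕ) : gridPoint R n (R * (n + 1)) = 0 := by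
  unfold gridPoint
  push_cast
  field_simp
  ring

lemma gridPoint_zero (R n : ℕ) : gridPoint R n 0 = -R := by
  simp [gridPoint]

lemma gridPoint_gridSize (R n : ℕ) : gridPoint R n (gridSize R n) = R := by
  unfold gridPoint gridSize
  push_cast
  field_simp
  ring

lemma gridPoint_mem (R n : ℕ) {j : ℕ} (hj : j ≤ gridSize R n) :
    gridPoint R n j ∈ Set.Icc (-(R : ℝ)) R :=
  ⟨(gridPoint_zero R n).symm.le.trans (gridPoint_mono R n (Nat.zero_le j)),
    (gridPoint_mono R n hj).trans (gridPoint_gridSize R n).le⟩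

/-- The second alternative is for the right endpoint `t = R`, to the right of which there is no
cell. -/
lemma gridIndex_spec {R n : ℕ} {t : ℝ} (ht : t ∈ Set.Icc (-(R : ℝ)) R) :
    (gridIndex R n t < gridSize R n ∧
      t ∈ Set.Icc (gridPoint R n (gridIndex R n t)) (gridPoint R n (gridIndex R n t + 1))) ∨
    t = gridPoint R n (gridIndex R n t) := by
  have hn : (0 : ℝ) < n + 1 := by positivity
  have h0 : 0 ≤ (t + R) * (n + 1) := mul_nonneg (by linarith [ht.1]) hn.le
  rcases ht.2.eq_or_lt with h | h
  · right
    have h1 : ⌊(t + R) * (n + 1)⌋₊ = gridSize R n := by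
      rw [h, show ((R : ℝ) + R) * (n + 1) = (gridSize R n : ℕ) by unfold gridSize; push_cast; ring,
        Nat.floor_natCast]
    rw [gridIndex, h1, min_self, gridPoint_gridSize, h]
  · left
    have h1 : ⌊(t + R) * (n + 1)⌋₊ < gridSize R n := by
      rw [Nat.floor_lt h0]
      unfold gridSize
      push_cast
      nlinarith
    have h2 : gridIndex R n t = ⌊(t + R) * (n + 1)⌋₊ := min_eq_left h1.le
    rw [h2]
    refine ⟨h1, ?_, ?_⟩
    · unfold gridPoint
      rw [sub_le_iff_le_add, div_le_iff₀ hn]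
      exact Nat.floor_le h0
    · unfold gridPoint
      rw [le_sub_iff_add_le, le_div_iff₀ hn]
      push_cast
      exact (Nat.lt_floor_add_one _).le

lemma abs_sub_gridPoint_le {R n : ℕ} {t : ℝ} (ht : t ∈ Set.Icc (-(R : ℝ)) R) :
    |t - gridPoint R n (gridIndex R n t)| ≤ 1 / (n + 1) := by
  rcases gridIndex_spec (n := n) ht with ⟨-, h1, h2⟩ | h
  · rw [abs_of_nonneg (by linarith), ← gridPoint_succ_sub R n (gridIndex R n t)]
    linarith
  · rw [← h, sub_self, abs_zero]
    positivity

/-- The increments of a function over the cells of the grid. -/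
def gridIncrement (R n : ℕ) (f : ℝ → ℝ) (j : Fin (gridSize R n)) : ℝ :=
  f (gridPoint R n (j + 1)) - f (gridPoint R n j)

/-- The weight of the increment over the `j`-th cell at time `t`. -/
def gridWeight (R n : ℕ) (j : Fin (gridSize R n)) (t : ℝ) : ℝ :=
  (if (j : ℕ) < gridIndex R n t then 1 else 0) - if (j : ℕ) < R * (n + 1) then 1 else 0

lemma abs_gridWeight_le (R n : ℕ) (j : Fin (gridSize R n)) (t : ℝ) : |gridWeight R n j t| ≤ 1 := by
  unfold gridWeight
  split_ifs <;> norm_num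

/-- The step function with prescribed increments that vanishes at `0`. -/
def gridPath (R n : ℕ) (u : Fin (gridSize R n) → ℝ) (t : ℝ) : ℝ := ∑ j, u j * gridWeight R n j t

lemma continuous_toPath_gridPath (R n : ℕ) : Continuous fun u => toPath (gridPath R n u) :=
  continuous_toPath_sum _ (abs_gridWeight_le R n)

/-- Telescoping from the central index `R (n + 1)`, whose grid point is `0`, to the index of `t`. -/
lemma gridPath_gridIncrement {R n : ℕ} {f : ℝ → ℝ} (hf : f 0 = 0) (t : ℝ) :
    gridPath R n (gridIncrement R n f) t = f (gridPoint R n (gridIndex R n t)) := by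
  have key : ∀ i ≤ gridSize R n,
      ∑ j : Fin (gridSize R n), gridIncrement R n f j * (if (j : ℕ) < i then 1 else 0)
        = f (gridPoint R n i) - f (gridPoint R n 0) := by
    intro i hi
    rw [← Finset.sum_range_sub (fun j => f (gridPoint R n j)) i]
    simp only [gridIncrement]
    rw [Fin.sum_univ_eq_sum_range (fun j => (f (gridPoint R n (j + 1)) - f (gridPoint R n j))
      * (if j < i then 1 else 0)) (gridSize R n)]
    simp only [mul_ite, mul_one, mul_zero]
    rw [← Finset.sum_filter]
    congr 1
    ext j
    simp only [Finset.mem_filter, Finset.mem_range]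
    omega
  simp only [gridPath, gridWeight, mul_sub, Finset.sum_sub_distrib]
  rw [key _ (gridIndex_le R n t), key _ (by unfold gridSize; nlinarith [Nat.zero_le (R * (n + 1))]),
    gridPoint_center, hf]
  ring

lemma eventually_abs_sub_lt {f : ℝ → ℝ} (hf : Continuous f) (R : ℕ) {δ : ℝ} (hδ : 0 < δ) :
    ∀ᶠ n : ℕ in atTop, ∀ s ∈ Set.Icc (-(R : ℝ)) R, ∀ t ∈ Set.Icc (-(R : ℝ)) R,
      |s - t| ≤ 1 / (n + 1) → |f s - f t| < δ := by
  obtain ⟨θ, hθ, h⟩ := Metric.uniformContinuousOn_iff.1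
    (isCompact_Icc.uniformContinuousOn_of_continuous hf.continuousOn) δ hδ
  filter_upwards [tendsto_one_div_add_atTop_nhds_zero_nat.eventually_lt_const hθ] with n hn s hs t ht
    hst
  exact h s hs t ht (hst.trans_lt hn)

lemma eventually_abs_sub_gridPath_lt {f : ℝ → ℝ} (hf : Continuous f) (hf0 : f 0 = 0) (R : ℕ) {δ : ℝ}
    (hδ : 0 < δ) : ∀ᶠ n : ℕ in atTop, ∀ t ∈ Set.Icc (-(R : ℝ)) R,
      |f t - gridPath R n (gridIncrement R n f) t| < δ := by
  filter_upwards [eventually_abs_sub_lt hf R hδ] with n hn t ht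
  rw [gridPath_gridIncrement hf0]
  exact hn t ht _ (gridPoint_mem R n (gridIndex_le R n t)) (abs_sub_gridPoint_le ht)

lemma tendsto_toPath_gridPath {f : ℝ → ℝ} (hf : Continuous f) (hf0 : f 0 = 0) :
    Tendsto (fun n => toPath (gridPath n n (gridIncrement n n f))) atTop (𝓝 (toPath f)) := by
  refine tendsto_toPath fun R δ hδ => ?_
  -- The interval is enlarged by one because the grid point of `t` may lie just outside `[-R, R]`.
  obtain ⟨θ, hθ, h⟩ := Metric.uniformContinuousOn_iff.1
    ((isCompact_Icc (a := -((R : ℝ) + 1)) (b := R + 1)).uniformContinuousOn_of_continuous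
      hf.continuousOn) δ hδ
  filter_upwards [tendsto_one_div_add_atTop_nhds_zero_nat.eventually_lt_const hθ,
    eventually_ge_atTop R] with n hn hRn t ht
  have hRn' : (R : ℝ) ≤ n := by exact_mod_cast hRn
  have ht' : t ∈ Set.Icc (-(n : ℝ)) n := ⟨by linarith [ht.1], by linarith [ht.2]⟩
  have h1 := abs_sub_gridPoint_le (n := n) ht'
  have h2 : (1 : ℝ) / (n + 1) ≤ 1 := by
    rw [div_le_one (by positivity)]
    linarith [(Nat.cast_nonneg n : (0 : ℝ) ≤ n)]
  have h3 := abs_le.1 (h1.trans h2)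
  rw [gridPath_gridIncrement hf0]
  refine h t ⟨by linarith [ht.1], by linarith [ht.2]⟩ _ ⟨?_, ?_⟩ (h1.trans_lt hn)
  · linarith [ht.1]
  · linarith [ht.2]

/-! ### Time changed Brownian motion -/

section Brownian

variable {Ω' : Type*} [MeasurableSpace Ω'] {P' : Measure Ω'}
  {W : ℝ → Ω' → ℝ} {G : ℝ → ℝ}

lemma IsTwoSidedBrownian.aemeasurable_sub (hW : IsTwoSidedBrownian P' W) (s t : ℝ) :
    AEMeasurable (fun ω => W t ω - W s ω) P' := by
  rcases le_total s t with h | h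
  · exact (hW.hasLaw_increment s t h).aemeasurable
  · exact (hW.hasLaw_increment t s h).aemeasurable.neg.congr (Eventually.of_forall fun ω => by simp)

lemma IsTwoSidedBrownian.aemeasurable_gridIncrement (hW : IsTwoSidedBrownian P' W) (R n : ℕ) :
    AEMeasurable (fun ω => gridIncrement R n fun t => W (G t) ω) P' :=
  aemeasurable_pi_lambda _ fun _ => hW.aemeasurable_sub _ _

lemma IsTwoSidedBrownian.ae_continuous (hW : IsTwoSidedBrownian P' W) (hG : Continuous G)
    (hG0 : G 0 = 0) : ∀ᵐ ω ∂P', (Continuous fun t => W (G t) ω) ∧ W (G 0) ω = 0 := by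
  filter_upwards [hW.continuous_paths, hW.zero] with ω h1 h2
  exact ⟨h1.comp hG, by rw [hG0, h2]⟩

/-- The path is an almost sure limit of step paths, each a continuous image of a finite-dimensional
random vector. -/
lemma IsTwoSidedBrownian.aestronglyMeasurable_toPath (hW : IsTwoSidedBrownian P' W)
    (hG : Continuous G) (hG0 : G 0 = 0) :
    AEStronglyMeasurable (fun ω => toPath fun t => W (G t) ω) P' := by
  let _ := UniformSpace.pseudoMetricSpace PathSpace
  refine aestronglyMeasurable_of_tendsto_ae atTop
    (f := fun n ω => toPath (gridPath n n (gridIncrement n n fun t => W (G t) ω))) (fun n => ?_) ?_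
  · exact (continuous_toPath_gridPath n n).comp_aestronglyMeasurable
      (hW.aemeasurable_gridIncrement n n).aestronglyMeasurable
  · filter_upwards [hW.ae_continuous hG hG0] with ω hω
    exact tendsto_toPath_gridPath hω.1 hω.2

lemma IsTwoSidedBrownian.map_gridIncrement [IsProbabilityMeasure P'] (hW : IsTwoSidedBrownian P' W)
    (hG : Monotone G) (R n : ℕ) :
    P'.map (fun ω => gridIncrement R n fun t => W (G t) ω) = Measure.pi fun j : Fin (gridSize R n) =>
      gaussianReal 0 (G (gridPoint R n (j + 1)) - G (gridPoint R n j)).toNNReal := by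
  have h1 := hW.indep_increments (gridSize R n) (fun j => G (gridPoint R n j))
    (hG.comp ((gridPoint_mono R n).comp Fin.val_strictMono.monotone))
  rw [iIndepFun_iff_map_fun_eq_pi_map fun j : Fin (gridSize R n) => hW.aemeasurable_sub _ _] at h1
  refine h1.trans (congrArg Measure.pi (funext fun j => ?_))
  exact (hW.hasLaw_increment _ _ (hG (gridPoint_mono R n (Nat.le_succ j)))).map_eq

lemma IsTwoSidedBrownian.eventually_abs_integral_sub_le [IsProbabilityMeasure P']
    (hW : IsTwoSidedBrownian P' W) (hG : Continuous G) (hG0 : G 0 = 0) (F : PathSpace →ᵇ ℝ)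
    {R : ℕ} {δ η : ℝ} (hδ : 0 < δ) (hη : 0 < η)
    (hF : ∀ f g : ℝ → ℝ, (∀ t ∈ Set.Icc (-(R : ℝ)) R, |f t - g t| < δ) →
      |F (toPath f) - F (toPath g)| ≤ η) :
    ∀ᶠ n in atTop, |∫ ω, F (toPath fun t => W (G t) ω) ∂P'
      - ∫ ω, F (toPath (gridPath R n (gridIncrement R n fun t => W (G t) ω))) ∂P'| ≤ 2 * η := by
  have hm1 : AEStronglyMeasurable (fun ω => F (toPath fun t => W (G t) ω)) P' :=
    F.continuous.comp_aestronglyMeasurable (hW.aestronglyMeasurable_toPath hG hG0)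
  have hm2 : ∀ n, AEStronglyMeasurable
      (fun ω => F (toPath (gridPath R n (gridIncrement R n fun t => W (G t) ω)))) P' := fun n =>
    (F.continuous.comp (continuous_toPath_gridPath R n)).comp_aestronglyMeasurable
      (hW.aemeasurable_gridIncrement R n).aestronglyMeasurable
  have hi1 : Integrable (fun ω => F (toPath fun t => W (G t) ω)) P' :=
    (integrable_const ‖F‖).mono' hm1 (Eventually.of_forall fun ω => F.norm_coe_le_norm _)
  have hi2 : ∀ n, Integrable
      (fun ω => F (toPath (gridPath R n (gridIncrement R n fun t => W (G t) ω)))) P' := fun n =>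
    (integrable_const ‖F‖).mono' (hm2 n) (Eventually.of_forall fun ω => F.norm_coe_le_norm _)
  -- Taking the maximum with `η` makes `D n ω` eventually equal to `η`, so dominated convergence
  -- applies although the difference itself is only known to be eventually at most `η`.
  set D : ℕ → Ω' → ℝ := fun n ω => max η |F (toPath fun t => W (G t) ω)
    - F (toPath (gridPath R n (gridIncrement R n fun t => W (G t) ω)))| with hD
  have hDm : ∀ n, AEStronglyMeasurable (D n) P' := fun n =>
    aestronglyMeasurable_const.sup (hm1.sub (hm2 n)).norm
  have hDb : ∀ n ω, ‖D n ω‖ ≤ η + (‖F‖ + ‖F‖) := by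
    intro n ω
    rw [Real.norm_of_nonneg (hη.le.trans (le_max_left _ _))]
    refine max_le (le_add_of_nonneg_right (by positivity)) ?_
    refine le_add_of_nonneg_of_le hη.le ((abs_sub _ _).trans ?_)
    exact add_le_add (F.norm_coe_le_norm _) (F.norm_coe_le_norm _)
  have hlim : Tendsto (fun n => ∫ ω, D n ω ∂P') atTop (𝓝 (∫ _, η ∂P')) := by
    refine tendsto_integral_of_dominated_convergence (fun _ => η + (‖F‖ + ‖F‖)) hDm
      (integrable_const _) (fun n => Eventually.of_forall (hDb n)) ?_
    filter_upwards [hW.ae_continuous hG hG0] with ω hω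
    refine tendsto_const_nhds.congr' ?_
    filter_upwards [eventually_abs_sub_gridPath_lt hω.1 hω.2 R hδ] with n hn
    exact (max_eq_left (hF _ _ hn)).symm
  simp only [integral_const, probReal_univ, one_smul] at hlim
  filter_upwards [hlim.eventually_le_const (show η < 2 * η by linarith)] with n hn
  rw [← integral_sub hi1 (hi2 n)]
  refine (abs_integral_le_integral_abs).trans (le_trans ?_ hn)
  exact integral_mono (hi1.sub (hi2 n)).abs
    ((integrable_const _).mono' (hDm n) (Eventually.of_forall (hDb n))) fun ω => le_max_right _ _

end Brownian

/-! ### Comparison of an outer expectation with an expectation -/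

/-- Replace `S` by a measurable hull of the same measure; then `g - e` and `g + e` are integrable
functions enclosing `f`, where `e` is `η` plus `2 * M` on the hull. -/
lemma abs_outerExpectation_sub_integral_le {Ω : Type*} [MeasurableSpace Ω] {P : Measure Ω}
    [IsProbabilityMeasure P] {f g : Ω → ℝ} {M η : ℝ} {S : Set Ω} (hη : 0 ≤ η)
    (hf : ∀ ω, |f ω| ≤ M) (hg : ∀ ω, |g ω| ≤ M) (hgm : AEStronglyMeasurable g P)
    (h : ∀ ω ∉ S, |f ω - g ω| ≤ η) :
    |outerExpectation P f - ∫ ω, g ω ∂P| ≤ η + 2 * M * P.real S := by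
  have hgi : Integrable g P := (integrable_const M).mono' hgm (Eventually.of_forall hg)
  set T := toMeasurable P S with hT
  have hTm : MeasurableSet T := measurableSet_toMeasurable P S
  have hTr : P.real T = P.real S := by simp only [measureReal_def, hT, measure_toMeasurable]
  set e : Ω → ℝ := fun ω => η + T.indicator (fun _ => 2 * M) ω with he
  have hei : Integrable e P := (integrable_const η).add ((integrable_const _).indicator hTm)
  have hev : ∫ ω, e ω ∂P = η + 2 * M * P.real S := by
    rw [he, integral_add (integrable_const η) ((integrable_const _).indicator hTm),
      integral_indicator_const _ hTm, hTr]
    simp [mul_comm]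
  have hfe : ∀ ω, |f ω - g ω| ≤ e ω := by
    intro ω
    have hM : 0 ≤ M := (abs_nonneg _).trans (hf ω)
    by_cases hω : ω ∈ T
    · simp only [he, Set.indicator_of_mem hω]
      have := (abs_sub (f ω) (g ω)).trans (add_le_add (hf ω) (hg ω))
      linarith
    · simp only [he, Set.indicator_of_notMem hω, add_zero]
      exact h ω fun hS => hω (subset_toMeasurable P S hS)
  rw [← hev, abs_le]
  constructor
  · have : ∫ ω, (g ω - e ω) ∂P ≤ outerExpectation P f := by
      refine le_outerExpectation (M := M) (fun ω => (abs_le.1 (hf ω)).2) fun k hk hfk => ?_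
      refine integral_mono (hgi.sub hei) hk fun ω => le_trans ?_ (hfk ω)
      linarith [(abs_le.1 (hfe ω)).1]
    rw [integral_sub hgi hei] at this
    linarith
  · have := outerExpectation_le (P := P) (g := fun ω => g ω + e ω) (M := -M)
      (fun ω => (abs_le.1 (hf ω)).1) (hgi.add hei) fun ω => by
        linarith [(abs_le.1 (hfe ω)).2]
    rw [integral_add hgi hei] at this
    linarith

end HardRods

namespace HardRods

/-! ### The functional limit theorem for a pair of sweeps -/

variable {c d : MarkedLine → ℝ} {J K : ℝ → Set MarkedLine} {μ : Measure MarkedLine}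

lemma increment_add_increment (a b e : ℝ) (p : MarkedLine) :
    increment c J a b p + increment c J b e p = increment c J a e p := by
  unfold increment
  ring

lemma increment_eq_zero {p : MarkedLine} (hp : c p = 0) (a b : ℝ) : increment c J a b p = 0 := by
  simp [increment, hp]

lemma increment_self (a : ℝ) (p : MarkedLine) : increment c J a a p = 0 := by
  simp [increment]

lemma IsSweep.measurable_increment (hJ : IsSweep J) (hc : Measurable c) (a b : ℝ) :
    Measurable (increment c J a b) :=
  hc.mul ((measurable_one.indicator (hJ.measurableSet b)).sub
    (measurable_one.indicator (hJ.measurableSet a)))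

lemma IsSweep.integrable_increment (hJ : IsSweep J) (hc : Measurable c) {κ : Measure MarkedLine}
    (h : ∀ R : ℕ, Integrable (increment c J (-R) R) κ) (a b : ℝ) :
    Integrable (increment c J a b) κ := by
  obtain ⟨R, hR⟩ := exists_nat_ge (max |a| |b|)
  have ha := abs_le.1 ((le_max_left _ _).trans hR)
  have hb := abs_le.1 ((le_max_right _ _).trans hR)
  refine (h R).abs.mono' (hJ.measurable_increment hc a b).aestronglyMeasurable
    (Eventually.of_forall fun p => ?_)
  rw [Real.norm_eq_abs]
  rcases le_total a b with hab | hab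
  · exact hJ.abs_increment_le ha.1 hab hb.2 p
  · rw [show increment c J a b p = -increment c J b a p by unfold increment; ring, abs_neg]
    exact hJ.abs_increment_le hb.1 hab ha.2 p

lemma IsSweep.isFinSq_increment_of_forall (hJ : IsSweep J)
    (h : ∀ R : ℕ, IsFinSq μ (increment c J (-R) R)) {a b : ℝ} (hab : a ≤ b) :
    IsFinSq μ (increment c J a b) := by
  obtain ⟨R, hR⟩ := exists_nat_ge (max |a| |b|)
  have ha := abs_le.1 ((le_max_left _ _).trans hR)
  have hb := abs_le.1 ((le_max_right _ _).trans hR)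
  exact hJ.isFinSq_increment ha.1 hab hb.2 (h R)

/-- The sum of the increments of two sweeps. -/
def pairIncrement (c : MarkedLine → ℝ) (J : ℝ → Set MarkedLine) (d : MarkedLine → ℝ)
    (K : ℝ → Set MarkedLine) (a b : ℝ) (p : MarkedLine) : ℝ :=
  increment c J a b p + increment d K a b p

lemma pairIncrement_sq (hcd : ∀ p, c p = 0 ∨ d p = 0) (a b : ℝ) (p : MarkedLine) :
    pairIncrement c J d K a b p ^ 2 = increment c J a b p ^ 2 + increment d K a b p ^ 2 := by
  unfold pairIncrement
  rcases hcd p with h | h <;> simp [increment_eq_zero h]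

lemma pairIncrement_disjoint (hJ : IsSweep J) (hK : IsSweep K) (hcd : ∀ p, c p = 0 ∨ d p = 0)
    {a b a' b' : ℝ} (hab : a ≤ b) (hba : b ≤ a') (hab' : a' ≤ b') (p : MarkedLine) :
    pairIncrement c J d K a b p = 0 ∨ pairIncrement c J d K a' b' p = 0 := by
  unfold pairIncrement
  rcases hcd p with h | h
  · simpa [increment_eq_zero h] using hK.increment_disjoint hab hba hab' p
  · simpa [increment_eq_zero h] using hJ.increment_disjoint hab hba hab' p

section Main

variable {Ω : ℝ → Type*} [∀ ε, MeasurableSpace (Ω ε)] {P : ∀ ε, Measure (Ω ε)}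
  [∀ ε, IsProbabilityMeasure (P ε)] {N : ∀ ε, Ω ε → Measure MarkedLine}

/-- The set of outcomes for which the fluctuations oscillate by more than `2 * δ` on `[s, u]`. -/
def oscillationSet (μ : Measure MarkedLine) (N : ∀ ε, Ω ε → Measure MarkedLine)
    (c : MarkedLine → ℝ) (J : ℝ → Set MarkedLine) (s u δ ε : ℝ) : Set (Ω ε) :=
  {ω | ∃ t ∈ Set.Icc s u, 2 * δ < |fluctuation μ ε (N ε ω) (increment c J s t)|}

/-- The bound is quadratic in `v`, so its sum over fine cells is small; a bound linear in `v` would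
not suffice. The condition `96 * v ≤ δ ^ 2` is `48 v / δ² ≤ 1/2`. -/
lemma IsSweep.eventually_measureReal_oscillationSet_le (hJ : IsSweep J) (hc : Measurable c)
    (hN : ∀ ε : ℝ, 0 < ε → IsPoissonProcess (P ε) (N ε) (ENNReal.ofReal ε⁻¹ • μ))
    {s u : ℝ} (hsu : s ≤ u) (hh : IsFinSq μ (increment c J s u)) {δ η v : ℝ} (hδ : 0 < δ)
    (hη : 0 < η) (hv : ∫ p, increment c J s u p ^ 2 ∂μ ≤ v) (hvδ : 96 * v ≤ δ ^ 2) :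
    ∀ᶠ ε in 𝓝[>] 0, (P ε).real (oscillationSet μ N c J s u δ ε)
      ≤ 2 * ((∫ x, x ^ 4 ∂(gaussianReal 0 1)) * v ^ 2 / δ ^ 4) + η := by
  have hK0 : 0 ≤ ∫ x : ℝ, x ^ 4 ∂(gaussianReal 0 1) := integral_nonneg fun x => by positivity
  have hσ0 : 0 ≤ ∫ p, increment c J s u p ^ 2 ∂μ := integral_nonneg fun p => sq_nonneg _
  filter_upwards [hh.eventually_measureReal_fluctuation_gt_le hN hδ (half_pos hη),
    self_mem_nhdsWithin] with ε hε hpos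
  have h1 := hJ.measureReal_exists_gt_le hc hpos (hN ε hpos) hsu hh hδ (by
    rw [div_le_iff₀ (by positivity)]
    linarith)
  refine h1.trans ?_
  have h2 : (∫ x, x ^ 4 ∂(gaussianReal 0 1)) * (∫ p, increment c J s u p ^ 2 ∂μ) ^ 2 / δ ^ 4
      ≤ (∫ x, x ^ 4 ∂(gaussianReal 0 1)) * v ^ 2 / δ ^ 4 := by
    gcongr
  linarith

variable {Ω' : Type*} [MeasurableSpace Ω'] {P' : Measure Ω'} [IsProbabilityMeasure P']
  {W : ℝ → Ω' → ℝ} {G : ℝ → ℝ} {X : ∀ ε, Ω ε → ℝ → ℝ}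

/-- The step path is a continuous function of finitely many increments, whose limiting Gaussian law
has variances `G t - G s`, the law of the increments of `W ∘ G`. -/
lemma tendsto_integral_gridPath (hW : IsTwoSidedBrownian P' W)
    (hN : ∀ ε : ℝ, 0 < ε → IsPoissonProcess (P ε) (N ε) (ENNReal.ofReal ε⁻¹ • μ))
    (hJ : IsSweep J) (hK : IsSweep K) (hcd : ∀ p, c p = 0 ∨ d p = 0)
    (hfc : ∀ R : ℕ, IsFinSq μ (increment c J (-R) R))
    (hfd : ∀ R : ℕ, IsFinSq μ (increment d K (-R) R)) (hGm : Monotone G)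
    (hG : ∀ s t, s ≤ t → ∫ p, pairIncrement c J d K s t p ^ 2 ∂μ = G t - G s)
    (R n : ℕ) (F : PathSpace →ᵇ ℝ) :
    Tendsto (fun ε => ∫ ω, F (toPath (gridPath R n fun j => fluctuation μ ε (N ε ω)
        (pairIncrement c J d K (gridPoint R n j) (gridPoint R n (j + 1))))) ∂(P ε)) (𝓝[>] 0)
      (𝓝 (∫ ω, F (toPath (gridPath R n (gridIncrement R n fun t => W (G t) ω))) ∂P')) := by
  have hg := gridPoint_mono R n
  have h1 := tendsto_integral_fluctuation (ι := Fin (gridSize R n))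
    (h := fun j => pairIncrement c J d K (gridPoint R n j) (gridPoint R n (j + 1))) hN
    (fun j => (hJ.isFinSq_increment_of_forall hfc (hg (Nat.le_succ j))).add
      (hK.isFinSq_increment_of_forall hfd (hg (Nat.le_succ j))))
    (by
      intro i j hij p
      rcases lt_or_gt_of_ne hij with h | h
      · exact pairIncrement_disjoint hJ hK hcd (hg (Nat.le_succ i)) (hg h) (hg (Nat.le_succ j)) p
      · exact (pairIncrement_disjoint hJ hK hcd (hg (Nat.le_succ j)) (hg h)
          (hg (Nat.le_succ i)) p).symm)
    (F.compContinuous ⟨_, continuous_toPath_gridPath R n⟩)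
  have h2 : (Measure.pi fun j : Fin (gridSize R n) => gaussianReal 0
      (∫ p, pairIncrement c J d K (gridPoint R n j) (gridPoint R n (j + 1)) p ^ 2 ∂μ).toNNReal)
      = P'.map fun ω => gridIncrement R n fun t => W (G t) ω := by
    rw [hW.map_gridIncrement hGm]
    refine congrArg Measure.pi (funext fun j => ?_)
    rw [hG _ _ (hg (Nat.le_succ j))]
  rw [h2, integral_map (hW.aemeasurable_gridIncrement R n)
    (BoundedContinuousFunction.continuous _).aestronglyMeasurable] at h1
  exact h1

omit [∀ ε, MeasurableSpace (Ω ε)] in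
-- The step path agrees with the process at grid points, and from there each of the two sweeps moves
-- it by at most `2δ`; hence `4δ < 5δ`.
lemma abs_sub_gridPath_lt_of_notMem (hJ : IsSweep J) (hK : IsSweep K)
    (hc : Measurable c) (hd : Measurable d)
    (hfc : ∀ R : ℕ, IsFinSq μ (increment c J (-R) R))
    (hfd : ∀ R : ℕ, IsFinSq μ (increment d K (-R) R))
    {ε δ : ℝ} (hδ : 0 < δ) {ω : Ω ε} (hωc : ∀ R : ℕ, Integrable (increment c J (-R) R) (N ε ω))
    (hωd : ∀ R : ℕ, Integrable (increment d K (-R) R) (N ε ω)) {R n : ℕ}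
    (hS : ∀ j < gridSize R n,
      ω ∉ oscillationSet μ N c J (gridPoint R n j) (gridPoint R n (j + 1)) δ ε ∧
      ω ∉ oscillationSet μ N d K (gridPoint R n j) (gridPoint R n (j + 1)) δ ε)
    {t : ℝ} (ht : t ∈ Set.Icc (-(R : ℝ)) R) :
    |fluctuation μ ε (N ε ω) (pairIncrement c J d K 0 t) - gridPath R n (fun j =>
        fluctuation μ ε (N ε ω)
          (pairIncrement c J d K (gridPoint R n j) (gridPoint R n (j + 1)))) t| < 5 * δ := by
  have hic := hJ.integrable_increment hc fun R => (hfc R).integrable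
  have hid := hK.integrable_increment hd fun R => (hfd R).integrable
  have hic' := hJ.integrable_increment hc hωc
  have hid' := hK.integrable_increment hd hωd
  have hadd : ∀ a b, fluctuation μ ε (N ε ω) (pairIncrement c J d K a b)
      = fluctuation μ ε (N ε ω) (increment c J a b)
        + fluctuation μ ε (N ε ω) (increment d K a b) := fun a b =>
    fluctuation_add (hic a b) (hid a b) (hic' a b) (hid' a b)
  have hc3 : ∀ a b e, fluctuation μ ε (N ε ω) (increment c J a b)
      + fluctuation μ ε (N ε ω) (increment c J b e)
        = fluctuation μ ε (N ε ω) (increment c J a e) := by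
    intro a b e
    rw [← fluctuation_add (hic a b) (hic b e) (hic' a b) (hic' b e)]
    congr 1
    ext p
    exact increment_add_increment a b e p
  have hd3 : ∀ a b e, fluctuation μ ε (N ε ω) (increment d K a b)
      + fluctuation μ ε (N ε ω) (increment d K b e)
        = fluctuation μ ε (N ε ω) (increment d K a e) := by
    intro a b e
    rw [← fluctuation_add (hid a b) (hid b e) (hid' a b) (hid' b e)]
    congr 1
    ext p
    exact increment_add_increment a b e p
  have hinc : (fun j : Fin (gridSize R n) => fluctuation μ ε (N ε ω)
      (pairIncrement c J d K (gridPoint R n j) (gridPoint R n (j + 1))))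
      = gridIncrement R n fun t => fluctuation μ ε (N ε ω) (pairIncrement c J d K 0 t) := by
    ext j
    simp only [gridIncrement, hadd]
    rw [← hc3 0 (gridPoint R n j) (gridPoint R n (j + 1)),
      ← hd3 0 (gridPoint R n j) (gridPoint R n (j + 1))]
    ring
  have h0 : fluctuation μ ε (N ε ω) (pairIncrement c J d K 0 0) = 0 := by
    simp [fluctuation, pairIncrement, increment_self]
  rw [hinc, gridPath_gridIncrement h0, hadd, hadd]
  set q := gridPoint R n (gridIndex R n t) with hq
  rw [← hc3 0 q t, ← hd3 0 q t]
  rcases gridIndex_spec (n := n) ht with ⟨hlt, hmem⟩ | heq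
  · obtain ⟨h1, h2⟩ := hS _ hlt
    have h3 := not_lt.1 fun h => h1 ⟨t, hmem, h⟩
    have h4 := not_lt.1 fun h => h2 ⟨t, hmem, h⟩
    rw [← hq] at h3 h4
    rw [abs_le] at h3 h4
    rw [abs_lt]
    constructor <;> linarith [h3.1, h3.2, h4.1, h4.2]
  · rw [← hq] at heq
    have := hc3 q t t
    have := hd3 q t t
    rw [← heq] at *
    rw [abs_lt]
    constructor <;> linarith

/-- Fluctuations along a pair of disjointly marked sweeps converge to a time changed Brownian
motion. -/
theorem tendstoInLaw_of_sweeps (hW : IsTwoSidedBrownian P' W)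
    (hN : ∀ ε : ℝ, 0 < ε → IsPoissonProcess (P ε) (N ε) (ENNReal.ofReal ε⁻¹ • μ))
    (hJ : IsSweep J) (hK : IsSweep K) (hc : Measurable c) (hd : Measurable d)
    (hcd : ∀ p, c p = 0 ∨ d p = 0)
    (hfc : ∀ R : ℕ, IsFinSq μ (increment c J (-R) R))
    (hfd : ∀ R : ℕ, IsFinSq μ (increment d K (-R) R)) (hGm : Monotone G) (hGc : Continuous G)
    (hG0 : G 0 = 0)
    (hG : ∀ s t, s ≤ t → ∫ p, pairIncrement c J d K s t p ^ 2 ∂μ = G t - G s)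
    (hX : ∀ ε, 0 < ε → ∀ᵐ ω ∂(P ε), ∀ t,
      X ε ω t = fluctuation μ ε (N ε ω) (pairIncrement c J d K 0 t)) :
    TendstoInLaw P X P' fun ω t => W (G t) ω := by
  refine ⟨hW.aestronglyMeasurable_toPath hGc hG0,
    tendsto_outerExpectation_of_uniformContinuous (X := fun ε ω => toPath (X ε ω))
      (hW.aestronglyMeasurable_toPath hGc hG0) fun F hFu => ?_⟩
  rw [Metric.tendsto_nhds]
  intro η' hη'
  -- Error budget: `η + 2 ‖F‖ · 2η` for replacing the process by its step path, `η` for the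
  -- finite-dimensional limit, `2η` for replacing the limit by its step path.
  obtain ⟨η, hη, hηη⟩ : ∃ η > 0, (4 + 4 * ‖F‖) * η < η' := by
    have hF : 0 ≤ ‖F‖ := norm_nonneg F
    refine ⟨η' / (5 + 4 * ‖F‖), by positivity, ?_⟩
    rw [mul_div_assoc', div_lt_iff₀ (by positivity)]
    nlinarith
  obtain ⟨R, δ₀, hδ₀, hF⟩ := exists_abs_sub_le_of_uniformContinuous hFu hη
  obtain ⟨δ, hδ, rfl⟩ : ∃ δ > 0, δ₀ = 5 * δ := ⟨δ₀ / 5, by positivity, by ring⟩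
  set κ := ∫ x : ℝ, x ^ 4 ∂(gaussianReal 0 1) with hκ
  have hκ0 : 0 ≤ κ := integral_nonneg fun x => by positivity
  set L := G R - G (-R) with hL
  have hL0 : 0 ≤ L := sub_nonneg.2 (hGm (by linarith [(Nat.cast_nonneg R : (0 : ℝ) ≤ R)]))
  -- `θ` bounds the growth of `G` over a cell, so the squared increments of `G` sum to at most `θ *
  -- L`. The `4` is Ottaviani's factor `2` times two sweeps.
  obtain ⟨θ, hθ, hθ1, hθ2⟩ : ∃ θ > 0, 96 * θ ≤ δ ^ 2 ∧ 4 * κ / δ ^ 4 * (θ * L) ≤ η := by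
    refine ⟨min (δ ^ 2 / 96) (η / (4 * κ / δ ^ 4 * L + 1)), by positivity, ?_, ?_⟩
    · have := min_le_left (δ ^ 2 / 96) (η / (4 * κ / δ ^ 4 * L + 1))
      linarith
    · have h1 := min_le_right (δ ^ 2 / 96) (η / (4 * κ / δ ^ 4 * L + 1))
      have h2 : 0 ≤ 4 * κ / δ ^ 4 * L := by positivity
      calc 4 * κ / δ ^ 4 * (min (δ ^ 2 / 96) (η / (4 * κ / δ ^ 4 * L + 1)) * L)
          = (4 * κ / δ ^ 4 * L) * min (δ ^ 2 / 96) (η / (4 * κ / δ ^ 4 * L + 1)) := by ring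
        _ ≤ (4 * κ / δ ^ 4 * L) * (η / (4 * κ / δ ^ 4 * L + 1)) := by gcongr
        _ ≤ η := by
          rw [mul_div_assoc', div_le_iff₀ (by positivity)]
          nlinarith
  obtain ⟨n, hn1, hn2⟩ := ((hW.eventually_abs_integral_sub_le hGc hG0 F (by positivity) hη hF).and
    (eventually_abs_sub_lt hGc R hθ)).exists
  set q := gridPoint R n with hq
  have hqm : Monotone q := gridPoint_mono R n
  have hΔ0 : ∀ j, 0 ≤ G (q (j + 1)) - G (q j) := fun j => sub_nonneg.2 (hGm (hqm (Nat.le_succ j)))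
  have hΔ : ∀ j < gridSize R n, G (q (j + 1)) - G (q j) ≤ θ := fun j hj =>
    (le_abs_self _).trans (hn2 _ (gridPoint_mem R n (Nat.succ_le_of_lt hj)) _
      (gridPoint_mem R n hj.le) (by rw [gridPoint_succ_sub, abs_of_pos (by positivity)])).le
  have hinc2 : ∀ j, ∫ p, increment c J (q j) (q (j + 1)) p ^ 2 ∂μ ≤ G (q (j + 1)) - G (q j) ∧
      ∫ p, increment d K (q j) (q (j + 1)) p ^ 2 ∂μ ≤ G (q (j + 1)) - G (q j) := by
    intro j
    have hle : q j ≤ q (j + 1) := hqm (Nat.le_succ j)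
    have h1 := (hJ.isFinSq_increment_of_forall hfc hle).sq
    have h2 := (hK.isFinSq_increment_of_forall hfd hle).sq
    have h3 := hG _ _ hle
    simp_rw [pairIncrement_sq hcd] at h3
    rw [integral_add h1 h2] at h3
    have h4 : 0 ≤ ∫ p, increment c J (q j) (q (j + 1)) p ^ 2 ∂μ := integral_nonneg fun p => sq_nonneg _
    have h5 : 0 ≤ ∫ p, increment d K (q j) (q (j + 1)) p ^ 2 ∂μ := integral_nonneg fun p => sq_nonneg _
    constructor <;> linarith
  set m := gridSize R n with hm
  -- Shared among the `2 * m` oscillation events; the `+ 1` covers `m = 0`.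
  set η₁ := η / (2 * m + 1) with hη₁
  have hη₁0 : 0 < η₁ := by positivity
  have hev : ∀ᶠ ε in 𝓝[>] 0, ∀ j ∈ Finset.range m,
      (P ε).real (oscillationSet μ N c J (q j) (q (j + 1)) δ ε)
          ≤ 2 * (κ * (G (q (j + 1)) - G (q j)) ^ 2 / δ ^ 4) + η₁ ∧
      (P ε).real (oscillationSet μ N d K (q j) (q (j + 1)) δ ε)
          ≤ 2 * (κ * (G (q (j + 1)) - G (q j)) ^ 2 / δ ^ 4) + η₁ := by
    rw [Filter.eventually_all_finset]
    intro j hj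
    have hle : q j ≤ q (j + 1) := hqm (Nat.le_succ j)
    have h96 : 96 * (G (q (j + 1)) - G (q j)) ≤ δ ^ 2 := by
      linarith [hΔ j (Finset.mem_range.1 hj)]
    exact (hJ.eventually_measureReal_oscillationSet_le hc hN hle
      (hJ.isFinSq_increment_of_forall hfc hle) hδ hη₁0 (hinc2 j).1 h96).and
      (hK.eventually_measureReal_oscillationSet_le hd hN hle
      (hK.isFinSq_increment_of_forall hfd hle) hδ hη₁0 (hinc2 j).2 h96)
  have hlim := Metric.tendsto_nhds.1
    (tendsto_integral_gridPath hW hN hJ hK hcd hfc hfd hGm hG R n F) η hη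
  filter_upwards [hev, hlim, self_mem_nhdsWithin] with ε hosc hfdd hε
  have hε : 0 < ε := hε
  set V : Ω ε → ℝ → ℝ := fun ω => gridPath R n fun j => fluctuation μ ε (N ε ω)
    (pairIncrement c J d K (gridPoint R n j) (gridPoint R n (j + 1))) with hV
  set S : Set (Ω ε) := {ω | ∃ t ∈ Set.Icc (-(R : ℝ)) R, 5 * δ ≤ |X ε ω t - V ω t|} with hS
  have hVm : AEStronglyMeasurable (fun ω => F (toPath (V ω))) (P ε) := by
    refine (F.continuous.comp (continuous_toPath_gridPath R n)).comp_aestronglyMeasurable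
      (AEMeasurable.aestronglyMeasurable (aemeasurable_pi_lambda _ fun j => ?_))
    exact ((hJ.isFinSq_increment_of_forall hfc (hqm (Nat.le_succ j))).add
      (hK.isFinSq_increment_of_forall hfd (hqm (Nat.le_succ j)))).aemeasurable_fluctuation (hN ε hε)
  have hSle : (P ε).real S ≤ 2 * η := by
    have hsub : S ≤ᵐ[P ε] ⋃ j ∈ Finset.range m,
        (oscillationSet μ N c J (q j) (q (j + 1)) δ ε
          ∪ oscillationSet μ N d K (q j) (q (j + 1)) δ ε) := by
      filter_upwards [hX ε hε, ae_all_iff.2 fun R => (hfc R).ae_integrable (hN ε hε),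
        ae_all_iff.2 fun R => (hfd R).ae_integrable (hN ε hε)] with ω h1 h2 h3
      rintro ⟨t, ht, hωt⟩
      by_contra hcon
      refine absurd hωt (not_le.2 ?_)
      rw [h1 t]
      refine abs_sub_gridPath_lt_of_notMem hJ hK hc hd hfc hfd hδ h2 h3 (fun j hj => ?_) ht
      have hcon' : ω ∉ ⋃ j ∈ Finset.range m, (oscillationSet μ N c J (q j) (q (j + 1)) δ ε
          ∪ oscillationSet μ N d K (q j) (q (j + 1)) δ ε) := hcon
      simp only [Set.mem_iUnion, Finset.mem_range, exists_prop, not_exists, not_and,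
        Set.mem_union, not_or] at hcon'
      exact hcon' j hj
    have hsum : ∑ j ∈ Finset.range m, (G (q (j + 1)) - G (q j)) = L := by
      rw [Finset.sum_range_sub (fun j => G (q j)) m, hq, hm, gridPoint_gridSize, gridPoint_zero]
    calc (P ε).real S ≤ (P ε).real (⋃ j ∈ Finset.range m,
          (oscillationSet μ N c J (q j) (q (j + 1)) δ ε
            ∪ oscillationSet μ N d K (q j) (q (j + 1)) δ ε)) :=
          ENNReal.toReal_mono (measure_ne_top _ _) (measure_mono_ae hsub)
      _ ≤ ∑ j ∈ Finset.range m, (P ε).real (oscillationSet μ N c J (q j) (q (j + 1)) δ ε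
            ∪ oscillationSet μ N d K (q j) (q (j + 1)) δ ε) := measureReal_biUnion_finset_le _ _
      _ ≤ ∑ j ∈ Finset.range m, (4 * κ / δ ^ 4 * (θ * (G (q (j + 1)) - G (q j))) + 2 * η₁) := by
          refine Finset.sum_le_sum fun j hj => (measureReal_union_le _ _).trans ?_
          obtain ⟨h1, h2⟩ := hosc j hj
          have h3 : κ * (G (q (j + 1)) - G (q j)) ^ 2 / δ ^ 4
              ≤ κ / δ ^ 4 * (θ * (G (q (j + 1)) - G (q j))) := by
            rw [mul_div_right_comm, sq]
            have := hΔ j (Finset.mem_range.1 hj)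
            have := hΔ0 j
            gcongr
          have h4 : 4 * κ / δ ^ 4 * (θ * (G (q (j + 1)) - G (q j)))
              = 4 * (κ / δ ^ 4 * (θ * (G (q (j + 1)) - G (q j)))) := by ring
          linarith
      _ = 4 * κ / δ ^ 4 * (θ * L) + m * (2 * η₁) := by
          rw [Finset.sum_add_distrib, ← Finset.mul_sum, ← Finset.mul_sum, hsum]
          simp
      _ ≤ η + η := by
          refine add_le_add hθ2 ?_
          rw [hη₁, ← mul_assoc, mul_div_assoc', div_le_iff₀ (by positivity)]
          nlinarith
      _ = 2 * η := by ring
  have hcmp := abs_outerExpectation_sub_integral_le (P := P ε) (f := fun ω => F (toPath (X ε ω)))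
    (g := fun ω => F (toPath (V ω))) (M := ‖F‖) (S := S) hη.le (fun ω => F.norm_coe_le_norm _)
    (fun ω => F.norm_coe_le_norm _) hVm (fun ω hω => hF _ _ fun t ht =>
      not_le.1 fun hle => hω ⟨t, ht, hle⟩)
  rw [Real.dist_eq] at hfdd ⊢
  have h1 : 2 * ‖F‖ * (P ε).real S ≤ 2 * ‖F‖ * (2 * η) := by gcongr
  rw [abs_le] at hcmp hn1
  rw [abs_lt] at hfdd ⊢
  constructor <;> linarith [hcmp.1, hcmp.2, hn1.1, hn1.2, hfdd.1, hfdd.2]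

end Main

end HardRods

namespace HardRods

/-! ### Lines meeting a segment -/

/-- The horizontal displacement of the point `q` from the line `p`. -/
def offset (p : MarkedLine) (q : ℝ × ℝ) : ℝ := q.1 - (p.1 + q.2 * p.2.1)

lemma mem_line_iff {p : MarkedLine} {q : ℝ × ℝ} : q ∈ line p ↔ offset p q = 0 := by
  unfold line offset
  constructor
  · rintro ⟨t, rfl⟩
    simp only
    ring
  · intro h
    refine ⟨q.2, Prod.ext ?_ rfl⟩
    simp only
    linarith

lemma mem_rightHalf_iff {p : MarkedLine} {q : ℝ × ℝ} : q ∈ rightHalf p ↔ 0 ≤ offset p q := by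
  simp [rightHalf, offset]

lemma mem_leftHalf_iff {p : MarkedLine} {q : ℝ × ℝ} : q ∈ leftHalf p ↔ offset p q < 0 := by
  simp [leftHalf, offset]

lemma offset_combo (p : MarkedLine) (a b : ℝ × ℝ) {s t : ℝ} (hst : s + t = 1) :
    offset p (s • a + t • b) = s * offset p a + t * offset p b := by
  simp only [offset, Prod.fst_add, Prod.snd_add, Prod.smul_fst, Prod.smul_snd, smul_eq_mul]
  linear_combination p.1 * hst

/-- The offset is affine along the segment, so it vanishes somewhere exactly when its end values do
not have the same strict sign. -/
lemma mem_linesMeeting_iff {p : MarkedLine} {a b : ℝ × ℝ} : p ∈ linesMeeting a b ↔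
    (offset p a ≤ 0 ∧ 0 ≤ offset p b) ∨ (offset p b ≤ 0 ∧ 0 ≤ offset p a) := by
  constructor
  · rintro ⟨q, hq, s, t, hs, ht, hst, rfl⟩
    rw [mem_line_iff, offset_combo p a b hst] at hq
    by_contra! hcon
    rcases lt_trichotomy (offset p a) 0 with ha | ha | ha
    · have hb := hcon.1 ha.le
      rcases hs.eq_or_lt with rfl | hs
      · have : t = 1 := by linarith
        subst this
        linarith
      · nlinarith
    · have h1 := hcon.1 ha.le
      have h2 := hcon.2 h1.le
      linarith
    · have hb : 0 < offset p b := by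
        by_contra hb
        have := hcon.2 (not_lt.1 hb)
        linarith
      rcases hs.eq_or_lt with rfl | hs
      · have : t = 1 := by linarith
        subst this
        linarith
      · nlinarith
  · intro h
    by_cases hab : offset p a = offset p b
    · have h0 : offset p a = 0 := by
        rcases h with h | h <;> linarith [h.1, h.2]
      exact ⟨a, mem_line_iff.2 h0, left_mem_segment ℝ a b⟩
    · have hne : offset p b - offset p a ≠ 0 := sub_ne_zero.2 (Ne.symm hab)
      have hst : offset p b / (offset p b - offset p a) + -offset p a / (offset p b - offset p a)
          = 1 := by
        field_simp
        ring
      refine ⟨_, ?_, offset p b / (offset p b - offset p a),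
        -offset p a / (offset p b - offset p a), ?_, ?_, hst, rfl⟩
      · rw [mem_line_iff, offset_combo p a b hst]
        field_simp
        ring
      · rcases h with h | h
        · exact div_nonneg h.2 (by linarith [h.1, h.2])
        · exact div_nonneg_of_nonpos h.1 (by linarith [h.1, h.2])
      · rcases h with h | h
        · exact div_nonneg (by linarith [h.1]) (by linarith [h.1, h.2])
        · exact div_nonneg_of_nonpos (by linarith [h.2]) (by linarith [h.1, h.2])

lemma mem_linesMeeting_self {p : MarkedLine} {a : ℝ × ℝ} : p ∈ linesMeeting a a ↔ offset p a = 0 := by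
  rw [mem_linesMeeting_iff, or_self, le_antisymm_iff]

lemma measurable_offset (q : ℝ × ℝ) : Measurable fun p : MarkedLine => offset p q := by
  unfold offset
  fun_prop

lemma continuous_offset (p : MarkedLine) : Continuous (offset p) := by
  unfold offset
  fun_prop

lemma measurableSet_linesMeeting (a b : ℝ × ℝ) : MeasurableSet (linesMeeting a b) := by
  have h : linesMeeting a b = ({p | offset p a ≤ 0} ∩ {p | 0 ≤ offset p b})
      ∪ ({p | offset p b ≤ 0} ∩ {p | 0 ≤ offset p a}) := by
    ext p
    exact mem_linesMeeting_iff
  have h1 : ∀ q, MeasurableSet {p : MarkedLine | offset p q ≤ 0} := fun q =>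
    measurableSet_le (measurable_offset q) measurable_const
  have h2 : ∀ q, MeasurableSet {p : MarkedLine | 0 ≤ offset p q} := fun q =>
    measurableSet_le measurable_const (measurable_offset q)
  rw [h]
  exact ((h1 a).inter (h2 b)).union ((h1 b).inter (h2 a))

variable {μ : Measure MarkedLine}

lemma lintegral_markSq_indicator {A : Set MarkedLine} (hA : MeasurableSet A) :
    ∫⁻ p, ENNReal.ofReal (A.indicator (fun p => p.2.2 ^ 2) p) ∂μ = markSq μ A := by
  rw [markSq, withDensity_apply _ hA, ← lintegral_indicator hA]
  congr 1
  ext p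
  by_cases hp : p ∈ A <;> simp [hp]

lemma integral_markSq_indicator {A : Set MarkedLine} (hA : MeasurableSet A) :
    ∫ p, A.indicator (fun p => p.2.2 ^ 2) p ∂μ = (markSq μ A).toReal := by
  rw [integral_eq_lintegral_of_nonneg_ae
    (Eventually.of_forall (Set.indicator_nonneg fun p _ => sq_nonneg _)),
    lintegral_markSq_indicator hA]
  exact ((by fun_prop : Measurable fun p : MarkedLine => p.2.2 ^ 2).indicator hA).aestronglyMeasurable

/-- The two terms in admissibility bound the measure of the support and the integral of the square.
-/
lemma IsAdmissible.isFinSq (hμ : IsAdmissible μ) {h : MarkedLine → ℝ} (hm : Measurable h)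
    {a b : ℝ × ℝ} (hle : ∀ p, |h p| ≤ (linesMeeting a b).indicator (fun p => |p.2.2|) p) :
    IsFinSq μ h where
  measurable := hm
  support := by
    have h1 := ENNReal.add_lt_top.1 (hμ a b)
    refine ne_top_of_le_ne_top h1.1.ne (measure_mono fun p hp => ?_)
    by_contra hpa
    have := hle p
    rw [Set.indicator_of_notMem hpa] at this
    exact hp (abs_nonpos_iff.1 this)
  sq := by
    have h1 := ENNReal.add_lt_top.1 (hμ a b)
    have hA := measurableSet_linesMeeting a b
    have h2 : Integrable ((linesMeeting a b).indicator fun p => p.2.2 ^ 2) μ := by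
      refine ⟨((by fun_prop : Measurable fun p : MarkedLine =>
        p.2.2 ^ 2).indicator hA).aestronglyMeasurable, ?_⟩
      rw [hasFiniteIntegral_iff_ofReal
        (Eventually.of_forall (Set.indicator_nonneg fun p _ => sq_nonneg _)),
        lintegral_markSq_indicator hA]
      exact h1.2
    refine h2.mono' (hm.pow_const 2).aestronglyMeasurable (Eventually.of_forall fun p => ?_)
    rw [Real.norm_of_nonneg (sq_nonneg _)]
    have h3 := hle p
    by_cases hp : p ∈ linesMeeting a b
    · rw [Set.indicator_of_mem hp] at h3 ⊢
      exact sq_le_sq.2 h3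
    · rw [Set.indicator_of_notMem hp] at h3 ⊢
      rw [abs_nonpos_iff.1 h3]
      norm_num

/-- `μ₂` does not see lines of mark zero, so `μ` itself may charge those through `q`; hence the
alternative. -/
lemma ae_mark_eq_zero_or_offset_ne_zero {q : ℝ × ℝ} (h : markSq μ (linesMeeting q q) = 0) :
    ∀ᵐ p ∂μ, p.2.2 = 0 ∨ offset p q ≠ 0 := by
  have hA := measurableSet_linesMeeting q q
  rw [markSq, withDensity_apply _ hA, lintegral_eq_zero_iff (by fun_prop)] at h
  have h1 := (ae_restrict_iff' hA).1 h
  filter_upwards [h1] with p hp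
  by_cases h0 : offset p q = 0
  · left
    have := hp (mem_linesMeeting_self.2 h0)
    simpa [sq_nonpos_iff] using this
  · exact Or.inr h0

/-! ### Sweeping the lines along a path -/

/-- The family `{τ ≤ t}`. -/
lemma isSweep_le {τ : MarkedLine → ℝ} (hτ : Measurable τ) : IsSweep fun t => {p | τ p ≤ t} where
  mono := fun _ _ hst _ hp => le_trans hp hst
  measurableSet := fun _ => measurableSet_le hτ measurable_const
  oneSided := Or.inl fun t p hp => by
    obtain ⟨t', h1, h2⟩ := exists_between (not_le.1 (show ¬ τ p ≤ t from hp))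
    exact ⟨t', h1, not_le.2 h2⟩

/-- The family `{τ < t}`. -/
lemma isSweep_lt {τ : MarkedLine → ℝ} (hτ : Measurable τ) : IsSweep fun t => {p | τ p < t} where
  mono := fun _ _ hst _ hp => lt_of_lt_of_le hp hst
  measurableSet := fun _ => measurableSet_lt hτ measurable_const
  oneSided := Or.inr fun t p hp => by
    obtain ⟨t', h1, h2⟩ := exists_between (show τ p < t from hp)
    exact ⟨t', h2, h1⟩

section Path

variable {c d : MarkedLine → ℝ} {J K : ℝ → Set MarkedLine}

lemma pairIncrement_add (a b e : ℝ) (p : MarkedLine) :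
    pairIncrement c J d K a b p + pairIncrement c J d K b e p = pairIncrement c J d K a e p := by
  unfold pairIncrement
  rw [← increment_add_increment (c := c) a b e, ← increment_add_increment (c := d) a b e]
  ring

lemma pairIncrement_symm_sq (a b : ℝ) (p : MarkedLine) :
    pairIncrement c J d K a b p ^ 2 = pairIncrement c J d K b a p ^ 2 := by
  unfold pairIncrement increment
  ring

lemma pairIncrement_sq_le (hJ : IsSweep J) (hK : IsSweep K) (hcd : ∀ p, c p = 0 ∨ d p = 0)
    {s a b u : ℝ} (hsa : s ≤ a) (hab : a ≤ b) (hbu : b ≤ u) (p : MarkedLine) :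
    pairIncrement c J d K a b p ^ 2 ≤ pairIncrement c J d K s u p ^ 2 := by
  rw [pairIncrement_sq hcd, pairIncrement_sq hcd]
  exact add_le_add (sq_le_sq.2 (hJ.abs_increment_le hsa hab hbu p))
    (sq_le_sq.2 (hK.abs_increment_le hsa hab hbu p))

variable {Ω : ℝ → Type*} [∀ ε, MeasurableSpace (Ω ε)] {P : ∀ ε, Measure (Ω ε)}
  [∀ ε, IsProbabilityMeasure (P ε)] {N : ∀ ε, Ω ε → Measure MarkedLine}
  {Ω' : Type*} [MeasurableSpace Ω'] {P' : Measure Ω'} [IsProbabilityMeasure P']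
  {W : ℝ → Ω' → ℝ} {X : ∀ ε, Ω ε → ℝ → ℝ}

/-- The functional limit theorem for the marks of the lines crossed along a path. -/
theorem tendstoInLaw_of_path (hμ : IsAdmissible μ) (hW : IsTwoSidedBrownian P' W)
    (hN : ∀ ε : ℝ, 0 < ε → IsPoissonProcess (P ε) (N ε) (ENNReal.ofReal ε⁻¹ • μ))
    {γ : ℝ → ℝ × ℝ} (hγ : Continuous γ) (hnull : ∀ t, markSq μ (linesMeeting (γ t) (γ t)) = 0)
    (hJ : IsSweep J) (hK : IsSweep K) (hc : Measurable c) (hd : Measurable d)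
    (hcd : ∀ p, c p = 0 ∨ d p = 0)
    (hle : ∀ s t p, |pairIncrement c J d K s t p|
      ≤ (linesMeeting (γ s) (γ t)).indicator (fun p => |p.2.2|) p)
    (heq : ∀ s t p, offset p (γ s) ≠ 0 → offset p (γ t) ≠ 0 → p ∈ linesMeeting (γ s) (γ t) →
      |pairIncrement c J d K s t p| = |p.2.2|)
    (hX : ∀ ε, 0 < ε → ∀ᵐ ω ∂(P ε), ∀ t, Integrable (pairIncrement c J d K 0 t) (N ε ω) →
      X ε ω t = fluctuation μ ε (N ε ω) (pairIncrement c J d K 0 t)) :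
    TendstoInLaw P X P' fun ω t =>
      W (Real.sign t * (markSq μ (linesMeeting (γ 0) (γ t))).toReal) ω := by
  have hfc : ∀ R : ℕ, IsFinSq μ (increment c J (-R) R) := fun R =>
    hμ.isFinSq (hJ.measurable_increment hc _ _) fun p => by
      refine le_trans ?_ (hle (-R) R p)
      rw [← sq_le_sq, pairIncrement_sq hcd]
      exact le_add_of_nonneg_right (sq_nonneg _)
  have hfd : ∀ R : ℕ, IsFinSq μ (increment d K (-R) R) := fun R =>
    hμ.isFinSq (hK.measurable_increment hd _ _) fun p => by
      refine le_trans ?_ (hle (-R) R p)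
      rw [← sq_le_sq, pairIncrement_sq hcd]
      exact le_add_of_nonneg_left (sq_nonneg _)
  have hX' : ∀ ε, 0 < ε → ∀ᵐ ω ∂(P ε), ∀ t,
      X ε ω t = fluctuation μ ε (N ε ω) (pairIncrement c J d K 0 t) := fun ε hε => by
    filter_upwards [hX ε hε, ae_all_iff.2 fun R => (hfc R).ae_integrable (hN ε hε),
      ae_all_iff.2 fun R => (hfd R).ae_integrable (hN ε hε)] with ω h h1 h2 t
    exact h t ((hJ.integrable_increment hc h1 0 t).add (hK.integrable_increment hd h2 0 t))
  have hfin : ∀ {s t}, s ≤ t → IsFinSq μ (pairIncrement c J d K s t) := fun hst =>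
    (hJ.isFinSq_increment_of_forall hfc hst).add (hK.isFinSq_increment_of_forall hfd hst)
  set V : ℝ → ℝ → ℝ := fun s t => ∫ p, pairIncrement c J d K s t p ^ 2 ∂μ with hV
  have hV0 : ∀ s t, 0 ≤ V s t := fun s t => integral_nonneg fun p => sq_nonneg _
  have hVsymm : ∀ s t, V s t = V t s := fun s t =>
    integral_congr_ae (Eventually.of_forall fun p => pairIncrement_symm_sq s t p)
  have hVadd : ∀ {s t u}, s ≤ t → t ≤ u → V s t + V t u = V s u := by
    intro s t u hst htu
    simp only [hV]
    rw [← integral_add (hfin hst).sq (hfin htu).sq]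
    congr 1
    ext p
    rw [← pairIncrement_add s t u]
    rcases pairIncrement_disjoint hJ hK hcd hst le_rfl htu p with h | h <;> simp [h]
  have hVself : ∀ s, V s s = 0 := fun s => by
    simp [hV, pairIncrement, increment_self]
  -- Lines through an endpoint have mark zero almost everywhere; on all other lines the squared
  -- increment is exactly the squared mark on the lines met.
  have hVmark : ∀ s t, (markSq μ (linesMeeting (γ s) (γ t))).toReal = V s t := by
    intro s t
    rw [← integral_markSq_indicator (measurableSet_linesMeeting _ _)]
    refine integral_congr_ae ?_
    filter_upwards [ae_mark_eq_zero_or_offset_ne_zero (hnull s),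
      ae_mark_eq_zero_or_offset_ne_zero (hnull t)] with p hs ht
    by_cases hp : p ∈ linesMeeting (γ s) (γ t)
    · rw [Set.indicator_of_mem hp]
      by_cases hr : p.2.2 = 0
      · have := hle s t p
        rw [Set.indicator_of_mem hp, hr, abs_zero] at this
        rw [hr, abs_nonpos_iff.1 this]
      · rw [← sq_abs, ← sq_abs (pairIncrement c J d K s t p),
          heq s t p (hs.resolve_left hr) (ht.resolve_left hr) hp]
    · have := hle s t p
      rw [Set.indicator_of_notMem hp] at this ⊢
      rw [abs_nonpos_iff.1 this]
      norm_num
  set G : ℝ → ℝ := fun t => Real.sign t * (markSq μ (linesMeeting (γ 0) (γ t))).toReal with hGdef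
  have hGpos : ∀ t, 0 ≤ t → G t = V 0 t := by
    intro t ht
    simp only [hGdef, hVmark]
    rcases ht.eq_or_lt with rfl | ht
    · simp [hVself]
    · rw [Real.sign_of_pos ht, one_mul]
  have hGneg : ∀ t, t ≤ 0 → G t = -V t 0 := by
    intro t ht
    simp only [hGdef, hVmark]
    rcases ht.eq_or_lt with rfl | ht
    · simp [hVself]
    · rw [Real.sign_of_neg ht, hVsymm 0 t, neg_one_mul]
  have hG : ∀ s t, s ≤ t → V s t = G t - G s := by
    intro s t hst
    rcases le_total 0 s with hs | hs
    · rw [hGpos s hs, hGpos t (hs.trans hst), ← hVadd hs hst]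
      ring
    · rcases le_total t 0 with ht | ht
      · rw [hGneg s hs, hGneg t ht, ← hVadd hst ht]
        ring
      · rw [hGneg s hs, hGpos t ht, ← hVadd hs ht]
        ring
  have hGm : Monotone G := fun s t hst => by
    have := hG s t hst
    linarith [hV0 s t]
  -- A line missing `γ t` is not met by the segment from `γ t` to `γ u` for `u` close to `t`. The
  -- remaining lines have mark zero almost everywhere, so dominated convergence applies.
  have hGc : Continuous G := by
    rw [continuous_iff_continuousAt]
    intro t
    have hlim : Tendsto (fun u => V t u) (𝓝 t) (𝓝 0) := by
      have h0 : ∫ _ : MarkedLine, (0 : ℝ) ∂μ = 0 := by simp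
      rw [← h0]
      have hnear : ∀ᶠ u in 𝓝 t, u ∈ Set.Icc (t - 1) (t + 1) :=
        Icc_mem_nhds (by linarith) (by linarith)
      refine tendsto_integral_filter_of_dominated_convergence
        (fun p => pairIncrement c J d K (t - 1) (t + 1) p ^ 2) ?_ ?_
        (hfin (by linarith : t - 1 ≤ t + 1)).sq ?_
      · refine Eventually.of_forall fun u => Measurable.aestronglyMeasurable ?_
        exact ((hJ.measurable_increment hc _ _).add (hK.measurable_increment hd _ _)).pow_const 2
      · filter_upwards [hnear] with u hu
        refine Eventually.of_forall fun p => ?_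
        rw [Real.norm_of_nonneg (sq_nonneg _)]
        rcases le_total t u with h | h
        · exact pairIncrement_sq_le hJ hK hcd (by linarith) h hu.2 p
        · rw [pairIncrement_symm_sq]
          exact pairIncrement_sq_le hJ hK hcd hu.1 h (by linarith) p
      · filter_upwards [ae_mark_eq_zero_or_offset_ne_zero (hnull t)] with p hp
        refine tendsto_const_nhds.congr' ?_
        have hzero : ∀ u, (p.2.2 = 0 ∨ p ∉ linesMeeting (γ t) (γ u)) →
            0 = pairIncrement c J d K t u p ^ 2 := by
          intro u hu
          have h1 : |pairIncrement c J d K t u p| ≤ 0 := by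
            refine (hle t u p).trans_eq ?_
            rcases hu with hu | hu
            · by_cases h : p ∈ linesMeeting (γ t) (γ u) <;> simp [h, hu]
            · rw [Set.indicator_of_notMem hu]
          rw [abs_nonpos_iff.1 h1]
          norm_num
        rcases hp with hp | hp
        · exact Eventually.of_forall fun u => hzero u (Or.inl hp)
        · have hcont := ((continuous_offset p).comp hγ).tendsto t
          rcases lt_or_gt_of_ne hp with hneg | hpos
          · filter_upwards [hcont.eventually_lt_const hneg] with u hu
            refine hzero u (Or.inr fun h => ?_)
            simp only [Function.comp_apply] at hu
            rcases mem_linesMeeting_iff.1 h with h | h <;> linarith [h.1, h.2]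
          · filter_upwards [hcont.eventually_const_lt hpos] with u hu
            refine hzero u (Or.inr fun h => ?_)
            simp only [Function.comp_apply] at hu
            rcases mem_linesMeeting_iff.1 h with h | h <;> linarith [h.1, h.2]
    rw [ContinuousAt, tendsto_iff_norm_sub_tendsto_zero]
    refine hlim.congr fun u => ?_
    rw [Real.norm_eq_abs]
    rcases le_total t u with h | h
    · rw [← hG t u h, abs_of_nonneg (hV0 _ _)]
    · rw [abs_sub_comm, ← hG u t h, abs_of_nonneg (hV0 _ _), hVsymm]
  exact tendstoInLaw_of_sweeps hW hN hJ hK hc hd hcd hfc hfd hGm hGc (by simp) hG hX'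

end Path

/-! ### Quasi-particles -/

/-- The signed mark `r (1{b ∈ right half-plane} - 1{a ∈ right half-plane})`. -/
def crossing (a b : ℝ × ℝ) (p : MarkedLine) : ℝ :=
  p.2.2 * ({p | b ∈ rightHalf p}.indicator 1 p - {p | a ∈ rightHalf p}.indicator 1 p)

lemma measurableSet_rightHalf (b : ℝ × ℝ) : MeasurableSet {p : MarkedLine | b ∈ rightHalf p} := by
  simp only [mem_rightHalf_iff]
  exact measurableSet_le measurable_const (measurable_offset b)

lemma measurable_crossing (a b : ℝ × ℝ) : Measurable (crossing a b) :=
  (by fun_prop : Measurable fun p : MarkedLine => p.2.2).mul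
    ((measurable_one.indicator (measurableSet_rightHalf b)).sub
      (measurable_one.indicator (measurableSet_rightHalf a)))

lemma crossing_add (a b e : ℝ × ℝ) (p : MarkedLine) :
    crossing a b p + crossing b e p = crossing a e p := by
  unfold crossing
  ring

lemma abs_crossing_le (a b : ℝ × ℝ) (p : MarkedLine) :
    |crossing a b p| ≤ (linesMeeting a b).indicator (fun p => |p.2.2|) p := by
  have ha := mem_rightHalf_iff (p := p) (q := a)
  have hb := mem_rightHalf_iff (p := p) (q := b)
  by_cases h : p ∈ linesMeeting a b
  · rw [Set.indicator_of_mem h]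
    by_cases h1 : a ∈ rightHalf p <;> by_cases h2 : b ∈ rightHalf p <;> simp [crossing, h1, h2]
  · rw [Set.indicator_of_notMem h]
    rw [mem_linesMeeting_iff] at h
    push Not at h
    by_cases h1 : a ∈ rightHalf p <;> by_cases h2 : b ∈ rightHalf p <;>
      simp only [crossing, Set.mem_ofPred_eq, h1, h2, Set.indicator_of_mem,
        Set.indicator_of_notMem, not_false_iff]
    · simp
    · exact absurd (h.2 (not_le.1 (fun h => h2 (hb.2 h))).le) (not_lt.2 (ha.1 h1))
    · exact absurd (h.1 (not_le.1 (fun h => h1 (ha.2 h))).le) (not_lt.2 (hb.1 h2))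
    · simp

lemma abs_crossing_eq {a b : ℝ × ℝ} {p : MarkedLine} (ha : offset p a ≠ 0) (hb : offset p b ≠ 0)
    (h : p ∈ linesMeeting a b) : |crossing a b p| = |p.2.2| := by
  have ha' := mem_rightHalf_iff (p := p) (q := a)
  have hb' := mem_rightHalf_iff (p := p) (q := b)
  rcases mem_linesMeeting_iff.1 h with ⟨h1, h2⟩ | ⟨h1, h2⟩
  · have h3 : a ∉ rightHalf p := fun h => ha (le_antisymm h1 (ha'.1 h))
    simp [crossing, h3, hb'.2 h2]
  · have h3 : b ∉ rightHalf p := fun h => hb (le_antisymm h1 (hb'.1 h))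
    simp [crossing, h3, ha'.2 h2]

/-- A line with the two points in opposite half-planes automatically meets the segment, so only the
half-plane conditions remain. -/
lemma surface_eq_integral {ν : Measure MarkedLine} {b : ℝ × ℝ}
    (h : Integrable (crossing (0, 0) b) ν) : surface ν b = ∫ p, crossing (0, 0) b p ∂ν := by
  have hR := measurableSet_rightHalf b
  have hR0 := measurableSet_rightHalf (0, 0)
  have hl : ∀ (p : MarkedLine) (q : ℝ × ℝ), q ∈ leftHalf p ↔ q ∉ rightHalf p := fun p q => by
    rw [mem_leftHalf_iff, mem_rightHalf_iff, not_le]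
  have hp : linesPos (0, 0) b = {p | b ∈ rightHalf p} \ {p | (0, 0) ∈ rightHalf p} := by
    ext p
    simp only [linesPos, Set.mem_ofPred_eq, Set.mem_sdiff, hl, mem_linesMeeting_iff,
      mem_rightHalf_iff]
    constructor
    · exact fun h => ⟨h.2.2, h.2.1⟩
    · exact fun h => ⟨Or.inl ⟨(not_le.1 h.2).le, h.1⟩, h.2, h.1⟩
  have hn : linesNeg (0, 0) b = {p | (0, 0) ∈ rightHalf p} \ {p | b ∈ rightHalf p} := by
    ext p
    simp only [linesNeg, Set.mem_ofPred_eq, Set.mem_sdiff, hl, mem_linesMeeting_iff,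
      mem_rightHalf_iff]
    constructor
    · exact fun h => ⟨h.2.1, h.2.2⟩
    · exact fun h => ⟨Or.inr ⟨(not_le.1 h.2).le, h.1⟩, h.1, h.2⟩
  have hpm := hR.diff hR0
  have hnm := hR0.diff hR
  have h1 : ∀ p, ({p | b ∈ rightHalf p} \ {p | (0, 0) ∈ rightHalf p}).indicator
      (fun p : MarkedLine => p.2.2) p = ({p | b ∈ rightHalf p} \
        {p | (0, 0) ∈ rightHalf p}).indicator (crossing (0, 0) b) p := by
    intro p
    by_cases h1 : b ∈ rightHalf p <;> by_cases h2 : (0, 0) ∈ rightHalf p <;>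
      simp [crossing, h1, h2]
  have h2 : ∀ p, ({p | (0, 0) ∈ rightHalf p} \ {p | b ∈ rightHalf p}).indicator
      (fun p : MarkedLine => p.2.2) p = -({p | (0, 0) ∈ rightHalf p} \
        {p | b ∈ rightHalf p}).indicator (crossing (0, 0) b) p := by
    intro p
    by_cases h1 : b ∈ rightHalf p <;> by_cases h2 : (0, 0) ∈ rightHalf p <;>
      simp [crossing, h1, h2]
  rw [surface, hp, hn, ← integral_indicator hpm, ← integral_indicator hnm]
  simp_rw [h1, h2]
  rw [integral_neg, sub_neg_eq_add, ← integral_add (h.indicator hpm) (h.indicator hnm)]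
  congr 1
  ext p
  by_cases h1 : b ∈ rightHalf p <;> by_cases h2 : (0, 0) ∈ rightHalf p <;>
      simp [crossing, h1, h2]

/-- Crossings are additive along concatenated segments, so the base point at the origin cancels. -/
lemma quasiParticle_sub {ν : Measure MarkedLine} {x v t : ℝ}
    (h0 : Integrable (crossing (0, 0) (x, 0)) ν)
    (h : Integrable (crossing (x, 0) (x + v * t, t)) ν) :
    quasiParticle ν x v t - quasiParticle ν x v 0
      = v * t + ∫ p, crossing (x, 0) (x + v * t, t) p ∂ν := by
  have h1 : Integrable (crossing (0, 0) (x + v * t, t)) ν := by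
    refine (h0.add h).congr (Eventually.of_forall fun p => ?_)
    exact crossing_add _ _ _ p
  have h2 : ∀ p, crossing (x, 0) (x + v * t, t) p
      = crossing (0, 0) (x + v * t, t) p - crossing (0, 0) (x, 0) p := fun p => by
    rw [← crossing_add (0, 0) (x, 0) (x + v * t, t)]
    ring
  simp_rw [h2]
  rw [integral_sub h1 h0, quasiParticle, quasiParticle, surface_eq_integral h1, mul_zero, add_zero,
    surface_eq_integral h0]
  ring

lemma quasiFluctuation_eq {κ : Measure MarkedLine} {ε x v t : ℝ} (hε : 0 < ε)
    (h0 : Integrable (crossing (0, 0) (x, 0)) μ)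
    (h : Integrable (crossing (x, 0) (x + v * t, t)) μ)
    (h0' : Integrable (crossing (0, 0) (x, 0)) κ)
    (h' : Integrable (crossing (x, 0) (x + v * t, t)) κ) :
    quasiFluctuation μ ε κ x v t = fluctuation μ ε κ (crossing (x, 0) (x + v * t, t)) := by
  rw [quasiFluctuation, quasiParticle_sub h0 h,
    quasiParticle_sub (h0'.smul_measure ENNReal.ofReal_ne_top)
      (h'.smul_measure ENNReal.ofReal_ne_top), integral_smul_measure,
    ENNReal.toReal_ofReal hε.le, fluctuation, smul_eq_mul]
  ring

/-- The mark of a line that is slower than `v`. -/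
def slowMark (v : ℝ) (p : MarkedLine) : ℝ := if p.2.1 < v then p.2.2 else 0

/-- The opposite of the mark of a line that is faster than `v`. -/
def fastMark (v : ℝ) (p : MarkedLine) : ℝ := if v < p.2.1 then -p.2.2 else 0

/-- The time at which the line `p` is crossed by the path `t ↦ x + v t`. -/
def crossingTime (x v : ℝ) (p : MarkedLine) : ℝ := (p.1 - x) / (v - p.2.1)

/-- The path enters the right half-plane of a slower line and leaves that of a faster one. As right
half-planes are closed, the first change takes effect at the crossing time and the second just after
it, hence `≤` and `<`. Lines of velocity `v` are never crossed; both marks vanish there, so the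
value of `crossingTime` at a zero denominator is harmless. -/
lemma pairIncrement_crossing (x v s t : ℝ) :
    pairIncrement (slowMark v) (fun t => {p | crossingTime x v p ≤ t}) (fastMark v)
      (fun t => {p | crossingTime x v p < t}) s t = crossing (x + v * s, s) (x + v * t, t) := by
  ext p
  have hR : ∀ t, (x + v * t, t) ∈ rightHalf p ↔ p.1 - x ≤ t * (v - p.2.1) := fun t => by
    simp only [rightHalf, Set.mem_ofPred_eq]
    constructor <;> intro h <;> linarith
  rcases lt_trichotomy p.2.1 v with h | h | h
  · have hτ : ∀ t, (x + v * t, t) ∈ rightHalf p ↔ crossingTime x v p ≤ t := fun t => by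
      rw [hR, crossingTime, div_le_iff₀ (sub_pos.2 h)]
    simp [pairIncrement, increment, slowMark, fastMark, crossing, h, h.le, Set.indicator, hτ]
  · have hτ : ∀ t, (x + v * t, t) ∈ rightHalf p ↔ p.1 - x ≤ 0 := fun t => by
      rw [hR, h, sub_self, mul_zero]
    simp [pairIncrement, increment, slowMark, fastMark, crossing, h, Set.indicator, hτ]
  · have hτ : ∀ t, (x + v * t, t) ∈ rightHalf p ↔ ¬ crossingTime x v p < t := fun t => by
      rw [hR, crossingTime, not_lt, le_div_iff_of_neg (sub_neg.2 h)]
    simp only [pairIncrement, increment, slowMark, fastMark, crossing, h, not_lt.2 h.le,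
      Set.indicator, Set.mem_ofPred_eq, hτ, if_true, if_false]
    by_cases h1 : crossingTime x v p < t <;> by_cases h2 : crossingTime x v p < s <;>
      simp [h1, h2]

/-! ### The two functional limit theorems -/

section Conclusion

variable {Ω : ℝ → Type*} [∀ ε, MeasurableSpace (Ω ε)] {P : ∀ ε, Measure (Ω ε)}
  [∀ ε, IsProbabilityMeasure (P ε)] {N : ∀ ε, Ω ε → Measure MarkedLine}
  {Ω' : Type*} [MeasurableSpace Ω'] {P' : Measure Ω'} [IsProbabilityMeasure P']
  {W : ℝ → Ω' → ℝ}

theorem tendstoInLaw_quasiFluctuation (hμ : IsAdmissible μ) (hW : IsTwoSidedBrownian P' W)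
    (hN : ∀ ε : ℝ, 0 < ε → IsPoissonProcess (P ε) (N ε) (ENNReal.ofReal ε⁻¹ • μ)) (x v : ℝ)
    (hnull : ∀ t : ℝ, markSq μ (linesMeeting (x + v * t, t) (x + v * t, t)) = 0) :
    TendstoInLaw P (fun ε ω t => quasiFluctuation μ ε (N ε ω) x v t) P'
      fun ω t => W (Real.sign t * (markSq μ (linesMeeting (x, 0) (x + v * t, t))).toReal) ω := by
  have hτ : Measurable (crossingTime x v) := by
    unfold crossingTime
    fun_prop
  have hslow : Measurable (slowMark v) :=
    Measurable.ite (measurableSet_lt (by fun_prop) measurable_const) (by fun_prop) measurable_const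
  have hfast : Measurable (fastMark v) :=
    Measurable.ite (measurableSet_lt measurable_const (by fun_prop)) (by fun_prop) measurable_const
  have hfin : ∀ a b, IsFinSq μ (crossing a b) := fun a b =>
    hμ.isFinSq (measurable_crossing a b) (abs_crossing_le a b)
  have key := tendstoInLaw_of_path (γ := fun t => (x + v * t, t))
    (X := fun ε ω t => quasiFluctuation μ ε (N ε ω) x v t) hμ hW hN (by fun_prop) hnull
    (isSweep_le hτ) (isSweep_lt hτ) hslow hfast (fun p => by
      unfold slowMark fastMark
      rcases lt_or_ge p.2.1 v with h | h
      · exact Or.inr (if_neg (not_lt.2 h.le))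
      · exact Or.inl (if_neg (not_lt.2 h)))
    (fun s t p => by rw [pairIncrement_crossing]; exact abs_crossing_le _ _ p)
    (fun s t p hs ht h => by rw [pairIncrement_crossing]; exact abs_crossing_eq hs ht h)
    (fun ε hε => by
      filter_upwards [(hfin (0, 0) (x, 0)).ae_integrable (hN ε hε)] with ω h2 t h3
      rw [pairIncrement_crossing, mul_zero, add_zero] at h3 ⊢
      exact quasiFluctuation_eq hε (hfin _ _).integrable (hfin _ _).integrable h2 h3)
  simpa only [mul_zero, add_zero] using key

/-- At a fixed time all lines are swept in the same direction, by their position at time `t`, so one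
sweep suffices and the other carries the mark `0`. The strict inequality matches the half-open
intervals in `mass`. -/
theorem tendstoInLaw_massFluctuation (hμ : IsAdmissible μ) (hW : IsTwoSidedBrownian P' W)
    (hN : ∀ ε : ℝ, 0 < ε → IsPoissonProcess (P ε) (N ε) (ENNReal.ofReal ε⁻¹ • μ)) (t : ℝ)
    (hnull : ∀ x : ℝ, markSq μ (linesMeeting (x, t) (x, t)) = 0) :
    TendstoInLaw P (fun ε ω x => massFluctuation μ ε (N ε ω) t x) P'
      fun ω x => W (Real.sign x * (markSq μ (linesMeeting (0, t) (x, t))).toReal) ω := by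
  have hτ : Measurable fun p : MarkedLine => p.1 + p.2.1 * t := by fun_prop
  have hpair : ∀ a b p, pairIncrement 0 (fun x => {p : MarkedLine | p.1 + p.2.1 * t < x})
      (fun p => p.2.2) (fun x => {p | p.1 + p.2.1 * t < x}) a b p
      = p.2.2 * ((if p.1 + p.2.1 * t < b then 1 else 0)
        - if p.1 + p.2.1 * t < a then 1 else 0) := fun a b p => by
    simp [pairIncrement, increment, Set.indicator]
  have hmass : ∀ (ν : Measure MarkedLine) (x : ℝ), mass x (evolve t ν)
      = ∫ p, pairIncrement 0 (fun x => {p : MarkedLine | p.1 + p.2.1 * t < x})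
      (fun p => p.2.2) (fun x => {p | p.1 + p.2.1 * t < x}) 0 x p ∂ν := by
    intro ν x
    rw [mass, evolve, integral_map (by fun_prop)]
    · congr 1
      ext p
      rw [hpair]
      simp only [Set.indicator, Set.mem_Ico, Pi.one_apply]
      congr 1
      split_ifs <;> first | (norm_num; done) | (exfalso; grind)
    · refine Measurable.aestronglyMeasurable ?_
      have h1 : ∀ a b : ℝ, Measurable fun p : MarkedLine =>
          (Set.Ico a b).indicator (1 : ℝ → ℝ) p.1 := fun a b =>
        (measurable_one.indicator measurableSet_Ico).comp measurable_fst
      exact (by fun_prop : Measurable fun p : MarkedLine => p.2.2).mul ((h1 0 x).sub (h1 x 0))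
  refine tendstoInLaw_of_path (γ := fun x => (x, t)) hμ hW hN (by fun_prop) hnull
    (isSweep_lt hτ) (isSweep_lt hτ) measurable_zero
    (by fun_prop : Measurable fun p : MarkedLine => p.2.2) (fun p => Or.inl rfl)
    (fun a b p => ?_) (fun a b p ha hb h => ?_)
    (fun ε _ => Eventually.of_forall fun ω x _ => ?_)
  · rw [hpair]
    by_cases h : p ∈ linesMeeting (a, t) (b, t)
    · rw [Set.indicator_of_mem h]
      split_ifs <;> simp
    · rw [Set.indicator_of_notMem h]
      rw [mem_linesMeeting_iff] at h
      simp only [offset] at h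
      split_ifs <;> first | (simp; done) | (exfalso; grind)
  · rw [hpair]
    rw [mem_linesMeeting_iff] at h
    simp only [offset] at h ha hb
    split_ifs <;> first | (simp; done) | (exfalso; grind)
  · rw [massFluctuation, hmass, hmass, fluctuation]

end Conclusion

end HardRods

end

theorem mainTheorem10
    (μ : Measure HardRods.MarkedLine) (hμ : HardRods.IsAdmissible μ)
    {Ω : ℝ → Type*} [∀ ε, MeasurableSpace (Ω ε)] (P : ∀ ε, Measure (Ω ε))
    [∀ ε, IsProbabilityMeasure (P ε)] (N : ∀ ε, Ω ε → Measure HardRods.MarkedLine)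
    (hN : ∀ ε : ℝ, 0 < ε →
      HardRods.IsPoissonProcess (P ε) (N ε) (ENNReal.ofReal ε⁻¹ • μ))
    {Ω' : Type*} [MeasurableSpace Ω'] (P' : Measure Ω') [IsProbabilityMeasure P']
    (W : ℝ → Ω' → ℝ) (hW : HardRods.IsTwoSidedBrownian P' W) :
    (∀ x v : ℝ,
      (∀ t : ℝ, HardRods.markSq μ
        (HardRods.linesMeeting (x + v * t, t) (x + v * t, t)) = 0) →
      HardRods.TendstoInLaw P
        (fun ε ω t => HardRods.quasiFluctuation μ ε (N ε ω) x v t) P'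
        (fun ω' t => W (Real.sign t *
          (HardRods.markSq μ (HardRods.linesMeeting (x, 0) (x + v * t, t))).toReal) ω')) ∧
    (∀ t : ℝ,
      (∀ x : ℝ, HardRods.markSq μ (HardRods.linesMeeting (x, t) (x, t)) = 0) →
      HardRods.TendstoInLaw P
        (fun ε ω x => HardRods.massFluctuation μ ε (N ε ω) t x) P'
        (fun ω' x => W (Real.sign x *
          (HardRods.markSq μ (HardRods.linesMeeting (0, t) (x, t))).toReal) ω')) :=
  ⟨fun x v h => HardRods.tendstoInLaw_quasiFluctuation hμ hW hN x v h,
    fun t h => HardRods.tendstoInLaw_massFluctuation hμ hW hN t h⟩
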